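/- Let $d\ge 1$. Write $|x|=\sum_{i}|x_i|$ for $x\in\mathbb R^d$ and let $\|\cdot\|$ be the corresponding operator norm on $d\times d$ matrices. Let $N$ be an $\mathbb N$-valued random variable and $A_1,A_2,\dots$ random $d\times d$ matrices with nonnegative entries, defined on the same probability space, such that $N\ge 1$ a.s., $1<\mathbb E[N]<\infty$, and a.s. $A_i\neq 0$ for $1\le i\le N$ and $A_i=0$ for $i>N$. Assume the Furstenberg–Kesten condition: there is a constant $c>1$ such that a.s. $$0<\max_{1\le i,j\le d}A_1(i,j)\le c\min_{1\le i,j\le d}A_1(i,j).$$ Let $Z$ be an $\mathbb R_+^d$-valued random variable with $\mathbb P[Z=0]=0$ which satisfies $$Z\overset{\mathcal L}{=}\sum_{i=1}^N A_iZ_i,$$ where $(Z_i)_{i\ge1}$ are i.i.d. copies of $Z$, independent of $(N,A_1,A_2,\dots)$. Let $a>0$ be such that $\mathbb E[\|A_1\|^{-a}]<\infty$. 1. If $\mathbb P[N=1]=0$, then $\mathbb E[|Z|^{-b}]<\infty$ for all $b\in(0,a)$. 2. Suppose $\mathbb P[N=1]>0$, and let $(\tilde A_i)_{i\ge1}$ be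 i.i.d. random matrices whose common law is that of $A_1$ conditioned on $\{N=1\}$. Then the limit $$\tilde\kappa(-a)=\lim_{n\to\infty}\mathbb E\big[\|\tilde A_n\cdots\tilde A_1\|^{-a}\big]^{1/n}$$ exists in $(0,\infty)$. Consider the statements (a) $\mathbb E[|Z|^{-a}]<\infty$; (b) $\tilde\kappa(-a)\,\mathbb P[N=1]<1$; (c) $\mathbb E[|Z|^{-b}]<\infty$ for all $b\in(0,a)$. Then (a) $\Rightarrow$ (b) $\Rightarrow$ (c). If in addition $\mathbb E[\|A_1\|^{-a-\varepsilon}]<\infty$ for some $\varepsilon>0$, then (a) $\Leftrightarrow$ (b). -/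

import Mathlib

open MeasureTheory ProbabilityTheory Filter Topology
open scoped ENNReal Matrix

namespace Smoothing

/-- The `L¹` norm `|x| = ∑ i, |x i|` of a vector. -/
noncomputable def vecNorm {d : ℕ} (x : Fin d → ℝ) : ℝ := ∑ i, |x i|

/-- The operator norm of a matrix for the `L¹` norm on vectors, i.e. its maximal column sum
(see `opNorm_isLeast`). -/
noncomputable def opNorm {d : ℕ} (a : Matrix (Fin d) (Fin d) ℝ) : ℝ := ⨆ j, ∑ i, |a i j|

theorem opNorm_isLeast {d : ℕ} (a : Matrix (Fin d) (Fin d) ℝ) :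
    IsLeast {C : ℝ | 0 ≤ C ∧ ∀ x, vecNorm (a *ᵥ x) ≤ C * vecNorm x} (opNorm a) := by
  have hb : BddAbove (Set.range fun j => ∑ i, |a i j|) := Set.finite_range _ |>.bddAbove
  refine ⟨⟨Real.iSup_nonneg fun j => Finset.sum_nonneg fun i _ => abs_nonneg _, fun x => ?_⟩, ?_⟩
  · calc vecNorm (a *ᵥ x) ≤ ∑ i, ∑ j, |a i j| * |x j| := by
          refine Finset.sum_le_sum fun i _ => ?_
          simp only [Matrix.mulVec, dotProduct, ← abs_mul]
          exact Finset.abs_sum_le_sum_abs _ _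
      _ = ∑ j, (∑ i, |a i j|) * |x j| := by
          rw [Finset.sum_comm]
          simp only [Finset.sum_mul]
      _ ≤ ∑ j, opNorm a * |x j| :=
          Finset.sum_le_sum fun j _ => mul_le_mul_of_nonneg_right (le_ciSup hb j) (abs_nonneg _)
      _ = opNorm a * vecNorm x := by rw [vecNorm, Finset.mul_sum]
  · rintro C ⟨h0, hC⟩
    refine Real.iSup_le (fun j => ?_) h0
    have h := hC (Pi.single j 1)
    have h1 : vecNorm (Pi.single j (1 : ℝ)) = 1 := by
      simp [vecNorm, Pi.single_apply, apply_ite abs]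
    rw [h1, mul_one] at h
    simpa [vecNorm] using h

variable {Ω : Type*} [MeasurableSpace Ω] {d : ℕ}

/-- The standing condition on `(N, A₁, A₂, …)`. The sequence is indexed from `0`, so that
`A i` stands for `A_{i+1}`. -/
structure PointProcessCondition (P : Measure Ω) (N : Ω → ℕ)
    (A : ℕ → Ω → Matrix (Fin d) (Fin d) ℝ) : Prop where
  one_le : ∀ᵐ ω ∂P, 1 ≤ N ω
  one_lt_mean : 1 < ∫⁻ ω, (N ω : ℝ≥0∞) ∂P
  mean_lt_top : ∫⁻ ω, (N ω : ℝ≥0∞) ∂P < ∞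
  nonneg : ∀ᵐ ω ∂P, ∀ i j k, 0 ≤ A i ω j k
  ne_zero : ∀ᵐ ω ∂P, ∀ i, i < N ω → A i ω ≠ 0
  eq_zero : ∀ᵐ ω ∂P, ∀ i, N ω ≤ i → A i ω = 0

/-- The Furstenberg–Kesten condition on a random matrix `M`: for some constant `c > 1`, almost
surely `0 < max M(i,j) ≤ c * min M(i,j)`. -/
def FurstenbergKesten (P : Measure Ω) (M : Ω → Matrix (Fin d) (Fin d) ℝ) : Prop :=
  ∃ c : ℝ, 1 < c ∧ ∀ᵐ ω ∂P,
    (∃ i j, 0 < M ω i j) ∧ ∀ i j k l, M ω i j ≤ c * M ω k l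

/-- The smoothing transform: the law of `∑_{i=1}^N A_i Z_i`, where `(Z_i)` are i.i.d. with law
the probability measure `η` and independent of `(N, A₁, A₂, …)`. -/
noncomputable def smoothingTransform (P : Measure Ω) (N : Ω → ℕ)
    (A : ℕ → Ω → Matrix (Fin d) (Fin d) ℝ) (η : Measure (Fin d → ℝ)) :
    Measure (Fin d → ℝ) :=
  (P.prod (Measure.infinitePi fun _ : ℕ => η)).map
    fun p => ∑ i ∈ Finset.range (N p.1), A i p.1 *ᵥ p.2 i

/-- The moment `E[‖M‖ ^ s]` of a random matrix, with values in `[0, ∞]`. -/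
noncomputable def matMoment (P : Measure Ω) (M : Ω → Matrix (Fin d) (Fin d) ℝ) (s : ℝ) : ℝ≥0∞ :=
  ∫⁻ ω, ENNReal.ofReal (opNorm (M ω)) ^ s ∂P

/-- The moment `E[|X| ^ s]` of a random vector, with values in `[0, ∞]`. -/
noncomputable def vecMoment (P : Measure Ω) (X : Ω → Fin d → ℝ) (s : ℝ) : ℝ≥0∞ :=
  ∫⁻ ω, ENNReal.ofReal (vecNorm (X ω)) ^ s ∂P

/-- `E[‖Ã_n ⋯ Ã_1‖ ^ s] ^ (1/n)`, where `Ã_1, …, Ã_n` are i.i.d. with the law of `A₁` conditioned on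
`N = 1`. They are realised as `A₁` evaluated at independent points `ω₁, …, ω_n`, each with law
`P[· | N = 1]`. -/
noncomputable def kappaSeq (P : Measure Ω) (N : Ω → ℕ)
    (A : ℕ → Ω → Matrix (Fin d) (Fin d) ℝ) (s : ℝ) (n : ℕ) : ℝ≥0∞ :=
  matMoment (Measure.pi fun _ : Fin n => ProbabilityTheory.cond P {ω | N ω = 1})
    (fun w => (List.ofFn fun k : Fin n => A 0 (w k.rev)).prod) s ^ ((n : ℝ)⁻¹)

/-- `κ̃(s) = lim_n E[‖Ã_n ⋯ Ã_1‖ ^ s] ^ (1/n)`. -/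
noncomputable def kappa (P : Measure Ω) (N : Ω → ℕ)
    (A : ℕ → Ω → Matrix (Fin d) (Fin d) ℝ) (s : ℝ) : ℝ≥0∞ :=
  limUnder atTop (kappaSeq P N A s)

end Smoothing

namespace Smoothing

/-! ### Deterministic estimates for nonnegative matrices. -/

section Deterministic

variable {d : ℕ}

/-! Write `p = P[N = 1]`, `H_k(x) = E[|Ã_k ⋯ Ã_1 x|^(-a)]` and `u_k = E[‖Ã_k ⋯ Ã_1‖^(-a)]`. The
Furstenberg–Kesten condition on the rightmost factor gives `u_k |x|^(-a) ≤ H_k(x) ≤ c^a u_k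
|x|^(-a)` for `x ≥ 0`. Hence `u` is multiplicative up to a constant, and Fekete's lemma yields `κ̃`
together with `κ̃^k ≤ K u_k` (`exists_growthRate`).

(a) ⇒ (b): iterating the fixed point equation along `N = 1` replaces `p^k H_k` by `p^(k+1) H_(k+1)`
and leaves behind the contribution of `N ≥ 2`. If `κ̃ p ≥ 1`, then `p^k H_k ≥ K⁻¹ |x|^(-a)`, so each
step leaves at least a fixed positive amount, and `E[|Z|^(-a)] = ∞` (`lintegral_negPow_eq_top`).

(b) ⇒ (a), and from there (c): if `κ̃ p < 1`, some `r > 1` makes `V = ∑ r^k p^k H_k` comparable to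
`|x|^(-a)`, while the part `N = 1` contracts `V` by `r⁻¹`. On `N ≥ 2`, either the second summand has
norm at least `s`, and `V` of the sum is bounded, or it is smaller than `s`, which is rare and
independent of the first summand. So `E[V(Z)] ≤ t E[V(Z)] + D` with `t < 1`. Truncating `V` makes
the left side finite, so that it can be absorbed (`lintegral_negPow_lt_top`). The case `p = 0` is
the same argument with `V = |x|^(-a)`. -/

theorem vecNorm_nonneg (x : Fin d → ℝ) : 0 ≤ vecNorm x :=
  Finset.sum_nonneg fun _ _ => abs_nonneg _

theorem vecNorm_eq_sum {x : Fin d → ℝ} (hx : ∀ i, 0 ≤ x i) : vecNorm x = ∑ i, x i :=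
  Finset.sum_congr rfl fun i _ => abs_of_nonneg (hx i)

theorem vecNorm_eq_zero_iff {x : Fin d → ℝ} : vecNorm x = 0 ↔ x = 0 := by
  rw [vecNorm, Finset.sum_eq_zero_iff_of_nonneg fun _ _ => abs_nonneg _]
  simp [funext_iff]

theorem vecNorm_mono {x y : Fin d → ℝ} (hx : ∀ i, 0 ≤ x i) (hxy : ∀ i, x i ≤ y i) :
    vecNorm x ≤ vecNorm y :=
  Finset.sum_le_sum fun i _ => by
    rw [abs_of_nonneg (hx i), abs_of_nonneg ((hx i).trans (hxy i))]
    exact hxy i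

theorem measurable_vecNorm : Measurable (vecNorm : (Fin d → ℝ) → ℝ) := by
  unfold vecNorm
  fun_prop

theorem opNorm_nonneg (B : Matrix (Fin d) (Fin d) ℝ) : 0 ≤ opNorm B := (opNorm_isLeast B).1.1

theorem vecNorm_mulVec_le (B : Matrix (Fin d) (Fin d) ℝ) (x : Fin d → ℝ) :
    vecNorm (B *ᵥ x) ≤ opNorm B * vecNorm x := (opNorm_isLeast B).1.2 x

theorem mulVec_nonneg {B : Matrix (Fin d) (Fin d) ℝ} (hB : ∀ i j, 0 ≤ B i j) {x : Fin d → ℝ}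
    (hx : ∀ i, 0 ≤ x i) (i : Fin d) : 0 ≤ (B *ᵥ x) i := by
  rw [Matrix.mulVec, dotProduct]
  exact Finset.sum_nonneg fun j _ => mul_nonneg (hB i j) (hx j)

theorem mulVec_mono {B : Matrix (Fin d) (Fin d) ℝ} (hB : ∀ i j, 0 ≤ B i j) {x y : Fin d → ℝ}
    (hxy : ∀ i, x i ≤ y i) (i : Fin d) : (B *ᵥ x) i ≤ (B *ᵥ y) i := by
  rw [Matrix.mulVec, Matrix.mulVec, dotProduct, dotProduct]
  exact Finset.sum_le_sum fun j _ => mul_le_mul_of_nonneg_left (hxy j) (hB i j)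

/-- If all column sums of a nonnegative matrix are comparable up to the factor `c`, then the
matrix expands nonnegative vectors by at least its norm divided by `c`. -/
theorem opNorm_mul_vecNorm_le {c : ℝ} (hc : 0 ≤ c) {B : Matrix (Fin d) (Fin d) ℝ}
    (hB : ∀ i j, 0 ≤ B i j) (hcol : ∀ j k, ∑ i, B i j ≤ c * ∑ i, B i k) {x : Fin d → ℝ}
    (hx : ∀ i, 0 ≤ x i) : opNorm B * vecNorm x ≤ c * vecNorm (B *ᵥ x) := by
  have hop : ∀ k, opNorm B ≤ c * ∑ i, B i k := fun k =>
    Real.iSup_le (fun j => by simpa only [abs_of_nonneg (hB _ _)] using hcol j k)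
      (mul_nonneg hc (Finset.sum_nonneg fun i _ => hB i k))
  have hBx : vecNorm (B *ᵥ x) = ∑ k, (∑ i, B i k) * x k := by
    rw [vecNorm_eq_sum (mulVec_nonneg hB hx)]
    simp only [Matrix.mulVec, dotProduct, Finset.sum_mul]
    exact Finset.sum_comm
  rw [hBx, vecNorm_eq_sum hx, Finset.mul_sum, Finset.mul_sum]
  refine Finset.sum_le_sum fun k _ => ?_
  rw [← mul_assoc]
  exact mul_le_mul_of_nonneg_right (hop k) (hx k)

theorem opNorm_one_le : opNorm (1 : Matrix (Fin d) (Fin d) ℝ) ≤ 1 :=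
  (opNorm_isLeast _).2 ⟨zero_le_one, fun x => by simp⟩

/-- The pointwise content of the Furstenberg–Kesten condition, together with nonnegativity. -/
structure IsFK (c : ℝ) (B : Matrix (Fin d) (Fin d) ℝ) : Prop where
  nonneg : ∀ i j, 0 ≤ B i j
  exists_pos : ∃ i j, 0 < B i j
  le_mul : ∀ i j k l, B i j ≤ c * B k l

theorem IsFK.pos {c : ℝ} {B : Matrix (Fin d) (Fin d) ℝ} (h : IsFK c B) (i j : Fin d) :
    0 < B i j := by
  obtain ⟨k, l, hkl⟩ := h.exists_pos
  refine (h.nonneg i j).lt_of_ne fun h0 => ?_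
  have := h.le_mul k l i j
  rw [← h0, mul_zero] at this
  exact absurd hkl this.not_gt

/-- Comparability of the columns of `M` survives left multiplication by any nonnegative matrix with
the same `c`, so the constant does not deteriorate along products. -/
theorem IsFK.opNorm_mul_vecNorm_le_of_mul {c : ℝ} (hc : 0 ≤ c) {B M : Matrix (Fin d) (Fin d) ℝ}
    (hB : ∀ i j, 0 ≤ B i j) (hM : IsFK c M) {x : Fin d → ℝ} (hx : ∀ i, 0 ≤ x i) :
    opNorm (B * M) * vecNorm x ≤ c * vecNorm ((B * M) *ᵥ x) := by
  refine opNorm_mul_vecNorm_le hc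
    (fun i j => ?_) (fun j k => ?_) hx
  · rw [Matrix.mul_apply]
    exact Finset.sum_nonneg fun k _ => mul_nonneg (hB i k) (hM.nonneg k j)
  rw [Finset.mul_sum]
  refine Finset.sum_le_sum fun i _ => ?_
  rw [Matrix.mul_apply, Matrix.mul_apply, Finset.mul_sum]
  refine Finset.sum_le_sum fun l _ => ?_
  calc B i l * M l j ≤ B i l * (c * M l k) := mul_le_mul_of_nonneg_left (hM.le_mul _ _ _ _) (hB i l)
    _ = c * (B i l * M l k) := by ring

theorem IsFK.opNorm_mul_vecNorm_le {c : ℝ} (hc : 0 ≤ c) {M : Matrix (Fin d) (Fin d) ℝ}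
    (hM : IsFK c M) {x : Fin d → ℝ} (hx : ∀ i, 0 ≤ x i) :
    opNorm M * vecNorm x ≤ c * vecNorm (M *ᵥ x) := by
  have h1 : ∀ i j, 0 ≤ (1 : Matrix (Fin d) (Fin d) ℝ) i j := fun i j => by
    rw [Matrix.one_apply]; split_ifs <;> norm_num
  simpa using hM.opNorm_mul_vecNorm_le_of_mul hc h1 hx

theorem IsFK.mulVec_pos {c : ℝ} {M : Matrix (Fin d) (Fin d) ℝ} (hM : IsFK c M) {x : Fin d → ℝ}
    (hx : ∀ i, 0 ≤ x i) (hx0 : x ≠ 0) (i : Fin d) : 0 < (M *ᵥ x) i := by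
  obtain ⟨j, hj⟩ := Function.ne_iff.1 hx0
  rw [Matrix.mulVec, dotProduct]
  exact Finset.sum_pos' (fun k _ => mul_nonneg (hM.nonneg i k) (hx k))
    ⟨j, Finset.mem_univ _, mul_pos (hM.pos i j) ((hx j).lt_of_ne (Ne.symm hj))⟩

/-- The function `x ↦ |x| ^ (-a)` with values in `[0, ∞]`. -/
noncomputable def negPow (a : ℝ) (x : Fin d → ℝ) : ℝ≥0∞ := ENNReal.ofReal (vecNorm x) ^ (-a)

theorem measurable_negPow (a : ℝ) : Measurable (negPow a : (Fin d → ℝ) → ℝ≥0∞) :=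
  (ENNReal.measurable_ofReal.comp measurable_vecNorm).pow_const _

theorem negPow_pos {a : ℝ} (ha : 0 < a) (x : Fin d → ℝ) : 0 < negPow a x := by
  rw [negPow, pos_iff_ne_zero, Ne, ENNReal.rpow_eq_zero_iff]
  simp [ha, ha.le]

theorem rpow_neg_anti {a : ℝ} (ha : 0 ≤ a) {s t : ℝ≥0∞} (h : s ≤ t) : t ^ (-a) ≤ s ^ (-a) := by
  rw [ENNReal.rpow_neg, ENNReal.rpow_neg]
  exact ENNReal.inv_le_inv.2 (ENNReal.rpow_le_rpow h ha)

theorem negPow_anti {a : ℝ} (ha : 0 ≤ a) {x y : Fin d → ℝ} (hx : ∀ i, 0 ≤ x i)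
    (hxy : ∀ i, x i ≤ y i) : negPow a y ≤ negPow a x :=
  rpow_neg_anti ha (ENNReal.ofReal_le_ofReal (vecNorm_mono hx hxy))

theorem le_negPow_mulVec {a : ℝ} (ha : 0 ≤ a) (B : Matrix (Fin d) (Fin d) ℝ) (x : Fin d → ℝ) :
    ENNReal.ofReal (opNorm B) ^ (-a) * negPow a x ≤ negPow a (B *ᵥ x) := by
  rw [negPow, ← ENNReal.mul_rpow_of_ne_top ENNReal.ofReal_ne_top ENNReal.ofReal_ne_top,
    ← ENNReal.ofReal_mul (opNorm_nonneg B)]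
  exact rpow_neg_anti ha (ENNReal.ofReal_le_ofReal (vecNorm_mulVec_le B x))

theorem negPow_mulVec_le {a c : ℝ} (ha : 0 ≤ a) (hc : 0 < c) {B : Matrix (Fin d) (Fin d) ℝ}
    {x : Fin d → ℝ} (h : opNorm B * vecNorm x ≤ c * vecNorm (B *ᵥ x)) :
    negPow a (B *ᵥ x) ≤
      ENNReal.ofReal c ^ a * (ENNReal.ofReal (opNorm B) ^ (-a) * negPow a x) := by
  have hc0 : ENNReal.ofReal c ≠ 0 := by simpa using hc
  have h1 : ENNReal.ofReal c ^ (-a) * negPow a (B *ᵥ x) ≤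
      ENNReal.ofReal (opNorm B) ^ (-a) * negPow a x := by
    rw [negPow, negPow, ← ENNReal.mul_rpow_of_ne_top ENNReal.ofReal_ne_top ENNReal.ofReal_ne_top,
      ← ENNReal.mul_rpow_of_ne_top ENNReal.ofReal_ne_top ENNReal.ofReal_ne_top,
      ← ENNReal.ofReal_mul (opNorm_nonneg B), ← ENNReal.ofReal_mul hc.le]
    exact rpow_neg_anti ha (ENNReal.ofReal_le_ofReal h)
  calc negPow a (B *ᵥ x)
      = ENNReal.ofReal c ^ a * (ENNReal.ofReal c ^ (-a) * negPow a (B *ᵥ x)) := by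
        rw [← mul_assoc, ← ENNReal.rpow_add _ _ hc0 ENNReal.ofReal_ne_top, add_neg_cancel,
          ENNReal.rpow_zero, one_mul]
    _ ≤ _ := by gcongr

end Deterministic

/-! ### Growth rates of almost multiplicative sequences. -/

section Fekete

/-- An almost multiplicative sequence has a growth rate, which controls it up to a constant. -/
theorem exists_tendsto_rpow_inv {u : ℕ → ℝ≥0∞} {K : ℝ≥0∞} (hK1 : 1 ≤ K) (hK : K ≠ ∞)
    (hu0 : ∀ n, u n ≠ 0) (hu : ∀ n, u n ≠ ∞) (hle : ∀ m n, u (m + n) ≤ K * (u m * u n))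
    (hge : ∀ m n, u m * u n ≤ K * u (m + n)) :
    ∃ κ : ℝ≥0∞, Tendsto (fun n => u n ^ ((n : ℝ)⁻¹)) atTop (𝓝 κ) ∧ 0 < κ ∧ κ < ∞ ∧
      ∀ n, κ ^ n ≤ K * u n := by
  set k : ℝ := K.toReal with hk
  have hk1 : 1 ≤ k := by
    simpa using ENNReal.toReal_mono hK hK1
  set v : ℕ → ℝ := fun n => (u n).toReal with hv
  have hvpos : ∀ n, 0 < v n := fun n => ENNReal.toReal_pos (hu0 n) (hu n)
  have hkpos : 0 < k := one_pos.trans_le hk1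
  have hle' : ∀ m n, v (m + n) ≤ k * (v m * v n) := fun m n => by
    have := ENNReal.toReal_mono (ENNReal.mul_ne_top hK (ENNReal.mul_ne_top (hu m) (hu n))) (hle m n)
    simpa [ENNReal.toReal_mul] using this
  have hge' : ∀ m n, v m * v n ≤ k * v (m + n) := fun m n => by
    have := ENNReal.toReal_mono (ENNReal.mul_ne_top hK (hu (m + n))) (hge m n)
    simpa [ENNReal.toReal_mul] using this
  -- The factor `k` inside the logarithm absorbs the multiplicative error and makes the sequence
  -- exactly subadditive.
  set s : ℕ → ℝ := fun n => Real.log (k * v n) with hs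
  have hsub : Subadditive s := fun m n => by
    rw [hs]
    dsimp only
    rw [← Real.log_mul (mul_pos hkpos (hvpos m)).ne' (mul_pos hkpos (hvpos n)).ne']
    refine Real.log_le_log (mul_pos hkpos (hvpos _)) ?_
    calc k * v (m + n) ≤ k * (k * (v m * v n)) := by gcongr; exact hle' m n
      _ = k * v m * (k * v n) := by ring
  set l : ℝ := v 1 / k with hl
  have hlpos : 0 < l := div_pos (hvpos 1) hkpos
  have hlow : ∀ n, l ^ n ≤ k * v n := fun n => by
    induction n with
    | zero =>
      have h := hle' 0 0
      rw [pow_zero]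
      exact le_of_mul_le_mul_right (by simpa [mul_assoc] using h) (hvpos 0)
    | succ n ih =>
      calc l ^ (n + 1) = l ^ n * l := pow_succ _ _
        _ ≤ k * v n * l := by gcongr
        _ = v n * v 1 := by rw [hl]; field_simp
        _ ≤ k * v (n + 1) := hge' n 1
  have hbdd : BddBelow (Set.range fun n => s n / n) := by
    -- The `0` accounts for the index `n = 0`, where `s 0 / 0 = 0`.
    refine ⟨min 0 (Real.log l), ?_⟩
    rintro _ ⟨n, rfl⟩
    rcases Nat.eq_zero_or_pos n with rfl | hn
    · simp
    · refine (min_le_right _ _).trans ?_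
      have hn' : (0 : ℝ) < n := by exact_mod_cast hn
      rw [le_div_iff₀ hn', mul_comm, ← Real.log_pow]
      exact Real.log_le_log (pow_pos hlpos n) (hlow n)
  have hlim := hsub.tendsto_lim hbdd
  have hlim2 : Tendsto (fun n : ℕ => Real.exp (s n / n - Real.log k / n)) atTop
      (𝓝 (Real.exp (hsub.lim - 0))) :=
    (Real.continuous_exp.tendsto _).comp
      (hlim.sub (tendsto_const_div_atTop_nhds_zero_nat (Real.log k)))
  refine ⟨ENNReal.ofReal (Real.exp hsub.lim), ?_, by simpa using Real.exp_pos _,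
    ENNReal.ofReal_lt_top, fun n => ?_⟩
  · have := ENNReal.tendsto_ofReal hlim2
    rw [sub_zero] at this
    refine this.congr fun n => ?_
    have h1 : s n / n - Real.log k / n = Real.log (v n) * (n : ℝ)⁻¹ := by
      rw [hs]
      dsimp only
      rw [Real.log_mul hkpos.ne' (hvpos n).ne']
      ring
    rw [h1, ← Real.rpow_def_of_pos (hvpos n), ← ENNReal.ofReal_rpow_of_pos (hvpos n), hv,
      ENNReal.ofReal_toReal (hu n)]
  -- The Fekete limit is an infimum, so it lies below each `s n / n`.
  · have h1 : Real.exp hsub.lim ^ n ≤ k * v n := by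
      rcases Nat.eq_zero_or_pos n with rfl | hn
      · simpa using hlow 0
      · have hn' : (0 : ℝ) < n := by exact_mod_cast hn
        have h2 := hsub.lim_le_div hbdd hn.ne'
        rw [le_div_iff₀ hn'] at h2
        rw [← Real.exp_nat_mul, mul_comm, ← Real.le_log_iff_exp_le (mul_pos hkpos (hvpos n))]
        exact h2
    rw [← ENNReal.ofReal_pow (Real.exp_pos _).le]
    refine (ENNReal.ofReal_le_ofReal h1).trans ?_
    rw [ENNReal.ofReal_mul hkpos.le, hk, hv, ENNReal.ofReal_toReal hK, ENNReal.ofReal_toReal (hu n)]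

end Fekete

/-! ### Products with the newest factor on the left. -/

section ReverseProduct

variable {Ω : Type*} {d : ℕ}

/-- The product `M(w_{n-1}) ⋯ M(w_0)`. -/
noncomputable def revProd (M : Ω → Matrix (Fin d) (Fin d) ℝ) (n : ℕ) (w : Fin n → Ω) :
    Matrix (Fin d) (Fin d) ℝ := (List.ofFn fun k : Fin n => M (w k.rev)).prod

theorem revProd_zero (M : Ω → Matrix (Fin d) (Fin d) ℝ) (w : Fin 0 → Ω) : revProd M 0 w = 1 := by
  simp [revProd]

/-- Splitting off the matrix applied first matches the recursion of `iterMoment` and puts a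
Furstenberg–Kesten matrix on the right. -/
theorem revProd_succ (M : Ω → Matrix (Fin d) (Fin d) ℝ) (n : ℕ) (w : Fin (n + 1) → Ω) :
    revProd M (n + 1) w = revProd M n (fun k => w k.succ) * M (w 0) := by
  rw [revProd, List.ofFn_succ', List.concat_eq_append, List.prod_append]
  simp [revProd, Fin.rev_castSucc]

theorem revProd_nonneg {M : Ω → Matrix (Fin d) (Fin d) ℝ} {n : ℕ} {w : Fin n → Ω}
    (hw : ∀ l i j, 0 ≤ M (w l) i j) (i j : Fin d) :
    0 ≤ revProd M n w i j := by
  induction n generalizing i j with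
  | zero => rw [revProd_zero, Matrix.one_apply]; split_ifs <;> norm_num
  | succ n ih =>
    rw [revProd_succ, Matrix.mul_apply]
    exact Finset.sum_nonneg fun k _ => mul_nonneg (ih (fun l => hw l.succ) i k) (hw 0 k j)

end ReverseProduct

/-! ### Negative moments of random products applied to a vector. -/

section IteratedMoment

variable {Ω : Type*} [MeasurableSpace Ω] {d : ℕ}

theorem measurable_mulVec {X : Type*} [MeasurableSpace X] {M : X → Matrix (Fin d) (Fin d) ℝ}
    (hM : ∀ i j, Measurable fun ω => M ω i j) {v : X → Fin d → ℝ} (hv : Measurable v) :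
    Measurable fun ω => M ω *ᵥ v ω := by
  refine measurable_pi_iff.2 fun i => ?_
  simp only [Matrix.mulVec, dotProduct]
  exact Finset.measurable_fun_sum _ fun j _ => (hM i j).mul ((measurable_pi_apply j).comp hv)

theorem measurable_opNorm {X : Type*} [MeasurableSpace X] {M : X → Matrix (Fin d) (Fin d) ℝ}
    (hM : ∀ i j, Measurable fun ω => M ω i j) : Measurable fun ω => opNorm (M ω) := by
  unfold opNorm
  refine Measurable.iSup fun j => Finset.measurable_fun_sum _ fun i _ => ?_
  exact continuous_abs.measurable.comp (hM i j)

/-- The function `x ↦ E[|M_k ⋯ M_1 x| ^ (-a)]` for independent `M_i` distributed as `M` under `ν`,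
defined by conditioning on `M_1`. The measure `ν` need not be normalised. -/
noncomputable def iterMoment (ν : Measure Ω) (M : Ω → Matrix (Fin d) (Fin d) ℝ) (a : ℝ) :
    ℕ → (Fin d → ℝ) → ℝ≥0∞
  | 0, x => negPow a x
  | k + 1, x => ∫⁻ ω, iterMoment ν M a k (M ω *ᵥ x) ∂ν

theorem measurable_revProd {M : Ω → Matrix (Fin d) (Fin d) ℝ}
    (hM : ∀ i j, Measurable fun ω => M ω i j) (n : ℕ) (i j : Fin d) :
    Measurable fun w : Fin n → Ω => revProd M n w i j := by
  induction n generalizing i j with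
  | zero => simp only [revProd_zero]; exact measurable_const
  | succ n ih =>
    simp only [revProd_succ, Matrix.mul_apply]
    refine Finset.measurable_fun_sum _ fun k _ => Measurable.mul ?_ ?_
    · exact (ih i k).comp 
        (measurable_pi_lambda (fun (w : Fin (n + 1) → Ω) (l : Fin n) => w l.succ) fun l =>
          measurable_pi_apply l.succ)
    · exact (hM k j).comp (measurable_pi_apply _)

variable {ν : Measure Ω} {M : Ω → Matrix (Fin d) (Fin d) ℝ} {a c : ℝ}

theorem measurable_iterMoment [SFinite ν] (hM : ∀ i j, Measurable fun ω => M ω i j) (k : ℕ) :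
    Measurable (iterMoment ν M a k) := by
  induction k with
  | zero => exact measurable_negPow a
  | succ k ih =>
    have h : Measurable fun p : (Fin d → ℝ) × Ω => iterMoment ν M a k (M p.2 *ᵥ p.1) :=
      ih.comp (measurable_mulVec (fun i j => (hM i j).comp measurable_snd) measurable_fst)
    exact h.lintegral_prod_right'

/-- Passes between `P` restricted to `N = 1`, which appears in the fixed point equation, and the
conditional law, which defines `κ̃`. -/
theorem iterMoment_smul (r : ℝ≥0∞) (k : ℕ) (hr : r ≠ ∞) (x : Fin d → ℝ) :
    iterMoment (r • ν) M a k x = r ^ k * iterMoment ν M a k x := by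
  induction k generalizing x with
  | zero => simp [iterMoment]
  | succ k ih =>
    simp only [iterMoment, ih]
    rw [lintegral_smul_measure, lintegral_const_mul' _ _ (ENNReal.pow_ne_top hr), smul_eq_mul,
      ← mul_assoc, pow_succ']

theorem iterMoment_anti (ha : 0 ≤ a) (hM0 : ∀ᵐ ω ∂ν, ∀ i j, 0 ≤ M ω i j) (k : ℕ)
    {x y : Fin d → ℝ} (hx : ∀ i, 0 ≤ x i) (hxy : ∀ i, x i ≤ y i) :
    iterMoment ν M a k y ≤ iterMoment ν M a k x := by
  induction k generalizing x y with
  | zero => exact negPow_anti ha hx hxy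
  | succ k ih =>
    refine lintegral_mono_ae (hM0.mono fun ω hω => ih (mulVec_nonneg hω hx) (mulVec_mono hω hxy))

theorem iterMoment_eq_lintegral_pi [SigmaFinite ν] (hM : ∀ i j, Measurable fun ω => M ω i j)
    (k : ℕ) (x : Fin d → ℝ) :
    iterMoment ν M a k x =
      ∫⁻ w, negPow a (revProd M k w *ᵥ x) ∂(Measure.pi fun _ : Fin k => ν) := by
  induction k generalizing x with
  | zero => simp [iterMoment, revProd_zero]
  | succ k ih =>
    have hmp := measurePreserving_piFinSuccAbove (fun _ : Fin (k + 1) => ν) 0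
    have hf : Measurable fun p : Ω × (Fin k → Ω) =>
        negPow a (revProd M k p.2 *ᵥ (M p.1 *ᵥ x)) :=
      (measurable_negPow a).comp (measurable_mulVec
        (fun i j => (measurable_revProd hM k i j).comp measurable_snd)
        (measurable_mulVec (fun i j => (hM i j).comp measurable_fst) measurable_const))
    calc iterMoment ν M a (k + 1) x
        = ∫⁻ ω, ∫⁻ w, negPow a (revProd M k w *ᵥ (M ω *ᵥ x))
            ∂(Measure.pi fun _ : Fin k => ν) ∂ν := by simp only [iterMoment, ih]
      _ = ∫⁻ p, negPow a (revProd M k p.2 *ᵥ (M p.1 *ᵥ x))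
            ∂(ν.prod (Measure.pi fun _ : Fin k => ν)) := (lintegral_prod _ hf.aemeasurable).symm
      _ = _ := by
        rw [← hmp.lintegral_comp hf]
        refine lintegral_congr fun w => ?_
        rw [revProd_succ, ← Matrix.mulVec_mulVec]
        rfl

theorem ae_pi_forall {k : ℕ} [SigmaFinite ν] {p : Ω → Prop} (h : ∀ᵐ ω ∂ν, p ω) :
    ∀ᵐ w ∂(Measure.pi fun _ : Fin k => ν), ∀ i, p (w i) :=
  eventually_all.2 fun i => (Measure.tendsto_eval_ae_ae (i := i)).eventually h

theorem matMoment_mul_negPow_le [SigmaFinite ν] (ha : 0 ≤ a)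
    (hM : ∀ i j, Measurable fun ω => M ω i j) (k : ℕ) (x : Fin d → ℝ) :
    matMoment (Measure.pi fun _ : Fin k => ν) (revProd M k) (-a) * negPow a x ≤
      iterMoment ν M a k x := by
  rw [iterMoment_eq_lintegral_pi hM, matMoment, ← lintegral_mul_const]
  · exact lintegral_mono fun w => le_negPow_mulVec ha _ _
  · exact (measurable_opNorm (measurable_revProd hM k)).ennreal_ofReal.pow_const _

/-- Converse to `matMoment_mul_negPow_le` up to `c ^ a`: the rightmost factor controls the whole
product. The empty product is the identity, where `1 ≤ c` suffices. -/
theorem iterMoment_le_matMoment [SigmaFinite ν] (ha : 0 ≤ a) (hc : 1 ≤ c)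
    (hM : ∀ i j, Measurable fun ω => M ω i j) (hFK : ∀ᵐ ω ∂ν, IsFK c (M ω)) (k : ℕ)
    {x : Fin d → ℝ} (hx : ∀ i, 0 ≤ x i) :
    iterMoment ν M a k x ≤ ENNReal.ofReal c ^ a *
      (matMoment (Measure.pi fun _ : Fin k => ν) (revProd M k) (-a) * negPow a x) := by
  have hc0 : 0 < c := one_pos.trans_le hc
  have hmeas : Measurable fun w : Fin k → Ω => ENNReal.ofReal (opNorm (revProd M k w)) ^ (-a) :=
    (measurable_opNorm (measurable_revProd hM k)).ennreal_ofReal.pow_const _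
  rw [iterMoment_eq_lintegral_pi hM, matMoment, ← lintegral_mul_const _ hmeas,
    ← lintegral_const_mul _ (hmeas.mul_const _)]
  refine lintegral_mono_ae ((ae_pi_forall hFK).mono fun w hw => negPow_mulVec_le ha hc0 ?_)
  cases k with
  | zero =>
    rw [revProd_zero, Matrix.one_mulVec]
    exact mul_le_mul_of_nonneg_right (opNorm_one_le.trans hc) (vecNorm_nonneg x)
  | succ k =>
    rw [revProd_succ]
    exact (hw 0).opNorm_mul_vecNorm_le_of_mul hc0.le
      (revProd_nonneg fun l => (hw l.succ).nonneg) hx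

/-- The bound `h` is applied to the last `m` matrices, acting on the image of `x` under the first
`n`; the induction integrates out these `n`. -/
theorem iterMoment_add_le {C : ℝ≥0∞} {m : ℕ} (hC : C ≠ ∞) (hM0 : ∀ᵐ ω ∂ν, ∀ i j, 0 ≤ M ω i j)
    (h : ∀ x : Fin d → ℝ, (∀ i, 0 ≤ x i) → iterMoment ν M a m x ≤ C * negPow a x) (n : ℕ)
    {x : Fin d → ℝ} (hx : ∀ i, 0 ≤ x i) :
    iterMoment ν M a (m + n) x ≤ C * iterMoment ν M a n x := by
  induction n generalizing x with
  | zero => exact h x hx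
  | succ n ih =>
    calc iterMoment ν M a (m + n + 1) x
        ≤ ∫⁻ ω, C * iterMoment ν M a n (M ω *ᵥ x) ∂ν :=
          lintegral_mono_ae (hM0.mono fun ω hω => ih (mulVec_nonneg hω hx))
      _ = _ := lintegral_const_mul' _ _ hC

theorem le_iterMoment_add {C : ℝ≥0∞} {m : ℕ} (hC : C ≠ ∞)
    (h : ∀ x : Fin d → ℝ, C * negPow a x ≤ iterMoment ν M a m x) (n : ℕ) (x : Fin d → ℝ) :
    C * iterMoment ν M a n x ≤ iterMoment ν M a (m + n) x := by
  induction n generalizing x with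
  | zero => exact h x
  | succ n ih =>
    calc C * iterMoment ν M a (n + 1) x
        = ∫⁻ ω, C * iterMoment ν M a n (M ω *ᵥ x) ∂ν := (lintegral_const_mul' _ _ hC).symm
      _ ≤ _ := lintegral_mono fun ω => ih _

/-- Existence of the growth rate of the negative moments of products of independent matrices
satisfying the Furstenberg–Kesten condition. -/
theorem exists_growthRate [IsProbabilityMeasure ν] (hd : 1 ≤ d) (ha : 0 < a) (hc : 1 ≤ c)
    (hM : ∀ i j, Measurable fun ω => M ω i j) (hFK : ∀ᵐ ω ∂ν, IsFK c (M ω))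
    (hmom : matMoment ν M (-a) < ∞) :
    ∃ κ K : ℝ≥0∞, K ≠ 0 ∧ K ≠ ∞ ∧
      Tendsto (fun n : ℕ => matMoment (Measure.pi fun _ : Fin n => ν) (revProd M n) (-a) ^
        ((n : ℝ)⁻¹)) atTop (𝓝 κ) ∧ 0 < κ ∧ κ < ∞ ∧
      (∀ n, κ ^ n ≤ K * matMoment (Measure.pi fun _ : Fin n => ν) (revProd M n) (-a)) ∧
      ∀ n, matMoment (Measure.pi fun _ : Fin n => ν) (revProd M n) (-a) ≠ ∞ := by
  set u : ℕ → ℝ≥0∞ := fun n => matMoment (Measure.pi fun _ : Fin n => ν) (revProd M n) (-a)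
    with hu_def
  -- A nonnegative unit vector, at which `iterMoment` equals `u n` up to the factor `L`.
  set e : Fin d → ℝ := Pi.single ⟨0, hd⟩ 1 with he_def
  have he : ∀ i, 0 ≤ e i := fun i => by
    rw [he_def, Pi.single_apply]; split_ifs <;> norm_num
  have hnorm : vecNorm e = 1 := by simp [vecNorm, he_def, Pi.single_apply, apply_ite abs]
  have hpow : negPow a e = 1 := by simp [negPow, hnorm]
  have he0 : e ≠ 0 := fun h => by
    rw [h, vecNorm_eq_zero_iff.2 rfl] at hnorm
    exact zero_ne_one hnorm
  set L : ℝ≥0∞ := ENNReal.ofReal c ^ a with hL_def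
  have hL1 : 1 ≤ L := ENNReal.one_le_rpow (by simpa using hc) ha
  have hL : L ≠ ∞ := ENNReal.rpow_ne_top_of_nonneg ha.le ENNReal.ofReal_ne_top
  have hM0 : ∀ᵐ ω ∂ν, ∀ i j, 0 ≤ M ω i j := hFK.mono fun ω h => h.nonneg
  have hlow : ∀ n x, u n * negPow a x ≤ iterMoment ν M a n x :=
    fun n x => matMoment_mul_negPow_le ha.le hM n x
  have hupp : ∀ n x, (∀ i, 0 ≤ x i) → iterMoment ν M a n x ≤ (L * u n) * negPow a x :=
    fun n x hx => (iterMoment_le_matMoment ha.le hc hM hFK n hx).trans_eq (mul_assoc _ _ _).symm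
  have hlow' : ∀ n, u n ≤ iterMoment ν M a n e := fun n => by simpa [hpow] using hlow n e
  have hupp' : ∀ n, iterMoment ν M a n e ≤ L * u n := fun n => by
    simpa [hpow] using hupp n e he
  have hu0fin : u 0 ≠ ∞ := ((hlow' 0).trans_lt (by simp [iterMoment, hpow])).ne
  have hu1fin : u 1 ≠ ∞ := by
    refine ((hlow' 1).trans_lt ?_).ne
    calc iterMoment ν M a 1 e = ∫⁻ ω, negPow a (M ω *ᵥ e) ∂ν := rfl
      _ ≤ ∫⁻ ω, L * (ENNReal.ofReal (opNorm (M ω)) ^ (-a) * negPow a e) ∂ν :=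
        lintegral_mono_ae (hFK.mono fun ω hω =>
          negPow_mulVec_le ha.le (one_pos.trans_le hc)
            (hω.opNorm_mul_vecNorm_le (zero_le_one.trans hc) he))
      _ = L * matMoment ν M (-a) := by
        simp only [hpow, mul_one]
        exact lintegral_const_mul' _ _ hL
      _ < ∞ := ENNReal.mul_lt_top hL.lt_top hmom
  have hne_of_iter : ∀ n, iterMoment ν M a n e ≠ 0 → u n ≠ 0 := fun n h h0 =>
    h (le_antisymm ((hupp' n).trans_eq (by rw [h0, mul_zero])) zero_le)
  have hu0ne : u 0 ≠ 0 := hne_of_iter 0 (by simp [iterMoment, hpow])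
  have hu1ne : u 1 ≠ 0 := by
    refine hne_of_iter 1 ?_
    have hmeas : Measurable fun ω => negPow a (M ω *ᵥ e) :=
      (measurable_negPow a).comp (measurable_mulVec hM measurable_const)
    change ∫⁻ ω, negPow a (M ω *ᵥ e) ∂ν ≠ 0
    rw [Ne, lintegral_eq_zero_iff hmeas]
    intro h
    obtain ⟨ω, hω⟩ := h.exists
    exact (negPow_pos ha _).ne' hω
  -- Finiteness of `u m` is kept as a premise because `hufin` is deduced from this bound, one factor
  -- at a time.
  have hle : ∀ m n, u m ≠ ∞ → u (m + n) ≤ L ^ 2 * (u m * u n) := fun m n hm =>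
    calc u (m + n) ≤ iterMoment ν M a (m + n) e := hlow' _
      _ ≤ L * u m * iterMoment ν M a n e :=
        iterMoment_add_le (ENNReal.mul_ne_top hL hm) hM0 (hupp m) n he
      _ ≤ L * u m * (L * u n) := by gcongr; exact hupp' n
      _ = L ^ 2 * (u m * u n) := by ring
  have hge : ∀ m n, u m ≠ ∞ → u m * u n ≤ L ^ 2 * u (m + n) := fun m n hm =>
    calc u m * u n ≤ u m * iterMoment ν M a n e := by gcongr; exact hlow' n
      _ ≤ iterMoment ν M a (m + n) e := le_iterMoment_add hm (hlow m) n e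
      _ ≤ L * u (m + n) := hupp' _
      _ ≤ L ^ 2 * u (m + n) := by
        gcongr
        exact le_self_pow₀ hL1 two_ne_zero
  have hL2 : L ^ 2 ≠ ∞ := ENNReal.pow_ne_top hL
  have hufin : ∀ n, u n ≠ ∞ := fun n => by
    induction n with
    | zero => exact hu0fin
    | succ n ih =>
      exact ((hle n 1 ih).trans_lt (ENNReal.mul_lt_top hL2.lt_top
        (ENNReal.mul_lt_top ih.lt_top hu1fin.lt_top))).ne
  have hune : ∀ n, u n ≠ 0 := fun n => by
    induction n with
    | zero => exact hu0ne
    | succ n ih =>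
      intro h
      have := hge n 1 (hufin n)
      rw [h, mul_zero] at this
      exact mul_ne_zero ih hu1ne (le_antisymm this zero_le)
  obtain ⟨κ, h1, h2, h3, h4⟩ := exists_tendsto_rpow_inv (one_le_pow₀ hL1) hL2 hune hufin
    (fun m n => hle m n (hufin m)) (fun m n => hge m n (hufin m))
  exact ⟨κ, L ^ 2, pow_ne_zero _ (one_pos.trans_le hL1).ne', hL2, h1, h2, h3, h4, hufin⟩

end IteratedMoment

/-! ### Absorption and summability in `[0, ∞]`. -/

section ENNRealLemmas

/-- The assumption `h` says nothing at `x = ∞`; this is why the function integrated later is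
truncated. -/
theorem le_of_le_mul_add {x t D : ℝ≥0∞} (hx : x ≠ ∞) (ht : t < 1) (h : x ≤ t * x + D) :
    x ≤ (1 - t)⁻¹ * D := by
  have h0 : 1 - t ≠ 0 := (tsub_pos_of_lt ht).ne'
  have h1 : 1 - t ≠ ∞ := ENNReal.sub_ne_top ENNReal.one_ne_top
  have h2 : (1 - t) * x ≤ D := by
    rw [ENNReal.sub_mul fun _ _ => hx, one_mul]
    exact tsub_le_iff_left.2 h
  calc x = (1 - t)⁻¹ * ((1 - t) * x) := by
        rw [← mul_assoc, ENNReal.inv_mul_cancel h0 h1, one_mul]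
    _ ≤ _ := by gcongr

theorem tsum_ne_top_of_eventually_le_geometric {f : ℕ → ℝ≥0∞} {C r : ℝ≥0∞} (hf : ∀ k, f k ≠ ∞)
    (hC : C ≠ ∞) (hr : r < 1) (h : ∀ᶠ k in atTop, f k ≤ C * r ^ k) : ∑' k, f k ≠ ∞ := by
  obtain ⟨n, hn⟩ := eventually_atTop.1 h
  have hle : ∀ k, f k ≤ C * r ^ k + if k < n then f k else 0 := fun k => by
    split_ifs with hk
    · exact le_add_self
    · exact (hn k (not_lt.1 hk)).trans le_self_add
  refine ((ENNReal.tsum_le_tsum hle).trans_lt ?_).ne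
  rw [ENNReal.tsum_add, ENNReal.tsum_mul_left, ENNReal.tsum_geometric]
  refine ENNReal.add_lt_top.2 ⟨ENNReal.mul_lt_top hC.lt_top ?_, ?_⟩
  · exact ENNReal.inv_lt_top.2 (tsub_pos_of_lt hr)
  · rw [tsum_eq_sum (s := Finset.range n) fun k hk => if_neg (by simpa using hk)]
    refine ENNReal.sum_lt_top.2 fun k _ => ?_
    split_ifs
    · exact (hf k).lt_top
    · exact ENNReal.zero_lt_top

end ENNRealLemmas

/-! ### The random sum in the smoothing transform. -/

section SmoothSum

variable {Ω : Type*} {d : ℕ}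

/-- The random vector `∑_{i<N} A_i z_i`. -/
noncomputable def smoothSum (N : Ω → ℕ) (A : ℕ → Ω → Matrix (Fin d) (Fin d) ℝ)
    (p : Ω × (ℕ → Fin d → ℝ)) : Fin d → ℝ := ∑ i ∈ Finset.range (N p.1), A i p.1 *ᵥ p.2 i

theorem sum_le_smoothSum {N : Ω → ℕ} {A : ℕ → Ω → Matrix (Fin d) (Fin d) ℝ}
    {p : Ω × (ℕ → Fin d → ℝ)} (hA0 : ∀ i j k, 0 ≤ A i p.1 j k)
    (hz : ∀ i j, 0 ≤ p.2 i j) {n : ℕ} (hn : n ≤ N p.1) (j : Fin d) :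
    ∑ i ∈ Finset.range n, (A i p.1 *ᵥ p.2 i) j ≤ smoothSum N A p j := by
  rw [smoothSum, Finset.sum_apply]
  exact Finset.sum_le_sum_of_subset_of_nonneg (Finset.range_subset_range.2 hn)
    fun i _ _ => mulVec_nonneg (hA0 i) (hz i) j

end SmoothSum

/-! ### The fixed point equation and infinite negative moments. -/

section FixedPoint

variable {Ω : Type*} [MeasurableSpace Ω] {d : ℕ}

theorem ae_prod_of_ae_fst {Y : Type*} [MeasurableSpace Y] {P : Measure Ω} {Q : Measure Y} [SFinite Q]
    {p : Ω → Prop} (h : ∀ᵐ ω ∂P, p ω) : ∀ᵐ q ∂(P.prod Q), p q.1 :=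
  Measure.quasiMeasurePreserving_fst.ae h

theorem ae_prod_of_ae_snd {Y : Type*} [MeasurableSpace Y] {P : Measure Ω} {Q : Measure Y} [SFinite Q]
    {p : Y → Prop} (h : ∀ᵐ ω ∂Q, p ω) : ∀ᵐ q ∂(P.prod Q), p q.2 :=
  Measure.quasiMeasurePreserving_snd.ae h

variable {P : Measure Ω} {N : Ω → ℕ}
  {A : ℕ → Ω → Matrix (Fin d) (Fin d) ℝ} {η : Measure (Fin d → ℝ)} [IsProbabilityMeasure η]
  {a c : ℝ}

theorem measurable_apply_mulVec {X : Type*} [MeasurableSpace X]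
    {M : Ω → Matrix (Fin d) (Fin d) ℝ} (hM : ∀ j k, Measurable fun ω => M ω j k) {f : X → Ω}
    {v : X → Fin d → ℝ} (hf : Measurable f) (hv : Measurable v) :
    Measurable fun p => M (f p) *ᵥ v p :=
  measurable_mulVec (fun j k => (hM j k).comp hf) hv

theorem measurable_smoothSum (hN : Measurable N) (hA : ∀ i j k, Measurable fun ω => A i ω j k) :
    Measurable (smoothSum N A) := by
  have h : Measurable fun q : (Ω × (ℕ → Fin d → ℝ)) × ℕ =>
      ∑ i ∈ Finset.range q.2, A i q.1.1 *ᵥ q.1.2 i :=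
    measurable_from_prod_countable_left fun n => by
      dsimp only
      exact Finset.measurable_fun_sum _ fun i _ => measurable_apply_mulVec (hA i) measurable_fst
        ((measurable_pi_apply i).comp measurable_snd)
  exact h.comp (measurable_id.prodMk (hN.comp measurable_fst))

theorem ae_infinitePi_forall {p : (Fin d → ℝ) → Prop} (h : ∀ᵐ x ∂η, p x) :
    ∀ᵐ z ∂(Measure.infinitePi fun _ : ℕ => η), ∀ i, p (z i) :=
  ae_all_iff.2 fun i =>
    (measurePreserving_eval_infinitePi (fun _ : ℕ => η) i).quasiMeasurePreserving.ae h

/-- A nonzero fixed point has positive coordinates almost surely. -/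
theorem ae_pos_of_fixedPoint (hN : Measurable N) (hA : ∀ i j k, Measurable fun ω => A i ω j k)
    (hcond : PointProcessCondition P N A) (hFK : ∀ᵐ ω ∂P, IsFK c (A 0 ω))
    (hfix : smoothingTransform P N A η = η) (hη : ∀ᵐ x ∂η, ∀ i, 0 ≤ x i)
    (hη0 : ∀ᵐ x ∂η, x ≠ 0) : ∀ᵐ x ∂η, ∀ i, 0 < x i := by
  have hset : MeasurableSet {x : Fin d → ℝ | ∀ i, 0 < x i} := by
    rw [Set.ofPred_forall]
    exact MeasurableSet.iInter fun i => measurableSet_lt measurable_const (measurable_pi_apply i)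
  rw [← hfix]
  refine (ae_map_iff (measurable_smoothSum hN hA).aemeasurable hset).2 ?_
  filter_upwards [ae_prod_of_ae_fst hcond.one_le, ae_prod_of_ae_fst hcond.nonneg,
    ae_prod_of_ae_fst hFK, ae_prod_of_ae_snd (ae_infinitePi_forall hη),
    ae_prod_of_ae_snd (ae_infinitePi_forall hη0)] with p h1 h2 h3 h4 h5 i
  -- The first summand alone has positive coordinates, since all entries of `A 0` are positive.
  refine (h3.mulVec_pos (h4 0) (h5 0) i).trans_le ?_
  simpa using sum_le_smoothSum h2 h4 h1 i

variable [IsProbabilityMeasure P]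

theorem setLIntegral_prod_fst {Y : Type*} [MeasurableSpace Y] {Q : Measure Y} [SFinite Q]
    (T : Set Ω) {F : Ω × Y → ℝ≥0∞} (hF : Measurable F) :
    ∫⁻ p in Prod.fst ⁻¹' T, F p ∂(P.prod Q) = ∫⁻ ω in T, ∫⁻ z, F (ω, z) ∂Q ∂P := by
  rw [← Set.prod_univ, ← Measure.prod_restrict, Measure.restrict_univ,
    lintegral_prod _ hF.aemeasurable]

theorem lintegral_infinitePi_eval {f : (Fin d → ℝ) → ℝ≥0∞} (hf : Measurable f) (i : ℕ) :
    ∫⁻ z, f (z i) ∂(Measure.infinitePi fun _ : ℕ => η) = ∫⁻ x, f x ∂η :=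
  (measurePreserving_eval_infinitePi (fun _ : ℕ => η) i).lintegral_comp hf

theorem lintegral_infinitePi_mul {f g : (Fin d → ℝ) → ℝ≥0∞} (hf : Measurable f)
    (hg : Measurable g) {i j : ℕ} (hij : i ≠ j) :
    ∫⁻ z, f (z i) * g (z j) ∂(Measure.infinitePi fun _ : ℕ => η) =
      (∫⁻ x, f x ∂η) * ∫⁻ x, g x ∂η := by
  have hind : IndepFun (fun z : ℕ → Fin d → ℝ => z i) (fun z => z j)
      (Measure.infinitePi fun _ : ℕ => η) :=
    (iIndepFun_infinitePi (P := fun _ : ℕ => η) (X := fun _ x => x)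
      fun _ => measurable_id).indepFun hij
  refine (lintegral_mul_eq_lintegral_mul_lintegral_of_indepFun''
    (hf.comp (measurable_pi_apply i)).aemeasurable (hg.comp (measurable_pi_apply j)).aemeasurable
    (hind.comp hf hg)).trans ?_
  exact congrArg₂ _ (lintegral_infinitePi_eval hf i) (lintegral_infinitePi_eval hg j)

/-- The fixed point equation, split according to whether `N = 1`. -/
theorem lintegral_eq_of_fixedPoint (hN : Measurable N)
    (hA : ∀ i j k, Measurable fun ω => A i ω j k) (hfix : smoothingTransform P N A η = η)
    {f : (Fin d → ℝ) → ℝ≥0∞} (hf : Measurable f) :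
    ∫⁻ x, f x ∂η = ∫⁻ x, ∫⁻ ω in {ω | N ω = 1}, f (A 0 ω *ᵥ x) ∂P ∂η +
      ∫⁻ p in Prod.fst ⁻¹' {ω | N ω = 1}ᶜ, f (smoothSum N A p)
        ∂(P.prod (Measure.infinitePi fun _ : ℕ => η)) := by
  have hS : MeasurableSet {ω | N ω = 1} := hN (measurableSet_singleton 1)
  have hsm := measurable_smoothSum hN hA
  have hAx : Measurable fun p : Ω × (Fin d → ℝ) => f (A 0 p.1 *ᵥ p.2) :=
    hf.comp (measurable_apply_mulVec (hA 0) measurable_fst measurable_snd)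
  have h1 : ∫⁻ x, f x ∂η = ∫⁻ p, f (smoothSum N A p)
      ∂(P.prod (Measure.infinitePi fun _ : ℕ => η)) := by
    conv_lhs => rw [← hfix]
    exact lintegral_map hf hsm
  rw [h1, ← lintegral_add_compl _ (measurable_fst hS), ← Set.preimage_compl]
  congr 1
  calc ∫⁻ p in Prod.fst ⁻¹' {ω | N ω = 1}, f (smoothSum N A p)
        ∂(P.prod (Measure.infinitePi fun _ : ℕ => η))
      = ∫⁻ p in Prod.fst ⁻¹' {ω | N ω = 1}, f (A 0 p.1 *ᵥ p.2 0)
        ∂(P.prod (Measure.infinitePi fun _ : ℕ => η)) := by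
        refine setLIntegral_congr_fun (measurable_fst hS) fun p hp => ?_
        have hp' : N p.1 = 1 := hp
        simp [smoothSum, hp']
    _ = ∫⁻ ω in {ω | N ω = 1}, ∫⁻ z, f (A 0 ω *ᵥ z 0)
          ∂(Measure.infinitePi fun _ : ℕ => η) ∂P :=
        setLIntegral_prod_fst _ (hf.comp (measurable_apply_mulVec (hA 0) measurable_fst
          ((measurable_pi_apply 0).comp measurable_snd)))
    _ = ∫⁻ ω in {ω | N ω = 1}, ∫⁻ x, f (A 0 ω *ᵥ x) ∂η ∂P :=
        lintegral_congr fun ω =>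
          lintegral_infinitePi_eval (hAx.comp (measurable_const.prodMk measurable_id)) 0
    _ = _ := lintegral_lintegral_swap hAx.aemeasurable

/-- If the unnormalised moments of the products do not decay, then the fixed point has an infinite
negative moment. -/
theorem lintegral_negPow_eq_top (hN : Measurable N) (hA : ∀ i j k, Measurable fun ω => A i ω j k)
    (hfix : smoothingTransform P N A η = η) (ha : 0 < a) (hP : P {ω | N ω = 1}ᶜ ≠ 0)
    {b : ℝ≥0∞} (hb0 : b ≠ 0)
    (hb : ∀ k x, b * negPow a x ≤ iterMoment (P.restrict {ω | N ω = 1}) (A 0) a k x) :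
    ∫⁻ x, negPow a x ∂η = ∞ := by
  set H := iterMoment (P.restrict {ω | N ω = 1}) (A 0) a with hH
  set T : Set (Ω × (ℕ → Fin d → ℝ)) := Prod.fst ⁻¹' {ω | N ω = 1}ᶜ with hT
  have hTm : MeasurableSet T := measurable_fst (hN (measurableSet_singleton 1)).compl
  set Q := P.prod (Measure.infinitePi fun _ : ℕ => η) with hQ
  have hmeas : Measurable fun p => negPow a (smoothSum N A p) :=
    (measurable_negPow a).comp (measurable_smoothSum hN hA)
  set R := ∫⁻ p in T, negPow a (smoothSum N A p) ∂Q with hR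
  have hR0 : R ≠ 0 := by
    rw [hR, Ne, lintegral_eq_zero_iff hmeas]
    intro h
    have h2 : ∀ᵐ p ∂(Q.restrict T), False := h.mono fun p hp => (negPow_pos ha _).ne' hp
    rw [ae_restrict_iff' hTm] at h2
    have h3 : Q T = 0 := by
      rw [measure_eq_zero_iff_ae_notMem]
      exact h2
    exact hP ((measurePreserving_fst.measure_preimage
      (hN (measurableSet_singleton 1)).compl.nullMeasurableSet).symm.trans h3)
  -- The part `N = 1` turns `H k` into `H (k + 1)`; the other part is at least `b * R` by `hb`,
  -- uniformly in `k`.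
  have hstep : ∀ k, b * R + ∫⁻ x, H (k + 1) x ∂η ≤ ∫⁻ x, H k x ∂η := fun k => by
    rw [lintegral_eq_of_fixedPoint hN hA hfix (measurable_iterMoment (hA 0) k), add_comm]
    refine add_le_add le_rfl ?_
    rw [hR, ← lintegral_const_mul _ hmeas]
    exact lintegral_mono fun p => hb k _
  have hall : ∀ n : ℕ, n * (b * R) + ∫⁻ x, H n x ∂η ≤ ∫⁻ x, negPow a x ∂η := fun n => by
    induction n with
    | zero => simp [hH, iterMoment]
    | succ n ih =>
      refine le_trans ?_ ih
      calc ((n + 1 : ℕ) : ℝ≥0∞) * (b * R) + ∫⁻ x, H (n + 1) x ∂η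
          = n * (b * R) + (b * R + ∫⁻ x, H (n + 1) x ∂η) := by push_cast; ring
        _ ≤ _ := by gcongr; exact hstep n
  by_contra hne
  have hbR : b * R ≠ 0 := mul_ne_zero hb0 hR0
  obtain ⟨n, hn⟩ := ENNReal.exists_nat_mul_gt hbR hne
  exact absurd ((le_self_add.trans (hall n))) hn.not_ge

end FixedPoint

/-! ### The Green function as a Lyapunov function. -/

section Green

variable {Ω : Type*} [MeasurableSpace Ω] {d : ℕ}

/-- The weighted Green function `∑ₖ r ^ k E[|M_k ⋯ M_1 x| ^ (-a)]`. -/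
noncomputable def green (ν : Measure Ω) (M : Ω → Matrix (Fin d) (Fin d) ℝ) (a : ℝ) (r : ℝ≥0∞)
    (x : Fin d → ℝ) : ℝ≥0∞ := ∑' k, r ^ k * iterMoment ν M a k x

variable {ν : Measure Ω} {M : Ω → Matrix (Fin d) (Fin d) ℝ} {a : ℝ} {r : ℝ≥0∞}

theorem measurable_green [SFinite ν] (hM : ∀ i j, Measurable fun ω => M ω i j) :
    Measurable (green ν M a r) :=
  Measurable.tsum fun k => (measurable_iterMoment hM k).const_mul _

theorem negPow_le_green (x : Fin d → ℝ) : negPow a x ≤ green ν M a r x := by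
  simpa [iterMoment, green] using ENNReal.le_tsum (f := fun k => r ^ k * iterMoment ν M a k x) 0

theorem green_anti (ha : 0 ≤ a) (hM0 : ∀ᵐ ω ∂ν, ∀ i j, 0 ≤ M ω i j) {x y : Fin d → ℝ}
    (hx : ∀ i, 0 ≤ x i) (hxy : ∀ i, x i ≤ y i) : green ν M a r y ≤ green ν M a r x :=
  ENNReal.tsum_le_tsum fun k => by
    gcongr
    exact iterMoment_anti ha hM0 k hx hxy

/-- One step shifts the series by one index, so only the term `k = 0` is lost. For `r > 1` this is a
strict contraction. -/
theorem mul_lintegral_green_le [SFinite ν] (hM : ∀ i j, Measurable fun ω => M ω i j)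
    (x : Fin d → ℝ) :
    r * ∫⁻ ω, green ν M a r (M ω *ᵥ x) ∂ν ≤ green ν M a r x := by
  have hmeas : ∀ k, Measurable fun ω => iterMoment ν M a k (M ω *ᵥ x) := fun k =>
    (measurable_iterMoment hM k).comp (measurable_mulVec hM measurable_const)
  have h1 : ∫⁻ ω, green ν M a r (M ω *ᵥ x) ∂ν = ∑' k, r ^ k * iterMoment ν M a (k + 1) x := by
    simp only [green]
    rw [lintegral_tsum fun k => ((hmeas k).const_mul _).aemeasurable]
    exact tsum_congr fun k => lintegral_const_mul _ (hmeas k)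
  rw [h1, ← ENNReal.tsum_mul_left]
  calc ∑' k, r * (r ^ k * iterMoment ν M a (k + 1) x)
      = ∑' k, r ^ (k + 1) * iterMoment ν M a (k + 1) x :=
        tsum_congr fun k => by rw [pow_succ', mul_assoc]
    _ ≤ green ν M a r x :=
        ENNReal.tsum_comp_le_tsum_of_injective (add_left_injective 1)
          fun k => r ^ k * iterMoment ν M a k x

end Green

/-! ### Finite negative moments from geometric decay. -/

section Finiteness

variable {Ω : Type*} [MeasurableSpace Ω] {d : ℕ} {P : Measure Ω}
  {N : Ω → ℕ} {A : ℕ → Ω → Matrix (Fin d) (Fin d) ℝ} {η : Measure (Fin d → ℝ)}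
  [IsProbabilityMeasure η] {a c : ℝ}

/-- A nonnegative nonzero matrix does not annihilate a vector with positive coordinates. -/
theorem vecNorm_mulVec_pos {B : Matrix (Fin d) (Fin d) ℝ} (hB : ∀ i j, 0 ≤ B i j) (hB0 : B ≠ 0)
    {x : Fin d → ℝ} (hx : ∀ i, 0 < x i) : 0 < vecNorm (B *ᵥ x) := by
  refine (vecNorm_nonneg _).lt_of_ne fun h => hB0 ?_
  have h0 := vecNorm_eq_zero_iff.1 h.symm
  ext i j
  have hi : ∑ k, B i k * x k = 0 := by
    have := congrFun h0 i
    rwa [Matrix.mulVec, dotProduct] at this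
  rw [Finset.sum_eq_zero_iff_of_nonneg fun k _ => mul_nonneg (hB i k) (hx k).le] at hi
  exact (mul_eq_zero.1 (hi j (Finset.mem_univ j))).resolve_right (hx j).ne'

theorem measurable_smallBall (hA : ∀ i j k, Measurable fun ω => A i ω j k) (i : ℕ) (s : ℝ) :
    Measurable fun ω => η {y | vecNorm (A i ω *ᵥ y) < s} := by
  have h : MeasurableSet {p : Ω × (Fin d → ℝ) | vecNorm (A i p.1 *ᵥ p.2) < s} :=
    measurableSet_lt (measurable_vecNorm.comp
      (measurable_apply_mulVec (hA i) measurable_fst measurable_snd)) measurable_const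
  exact measurable_measure_prodMk_left h

/-- On the event `N ≥ 2` the second summand is unlikely to be small, also after weighting with an
integrable function. -/
theorem exists_lintegral_smallBall_lt (hN : Measurable N)
    (hA : ∀ i j k, Measurable fun ω => A i ω j k) (hcond : PointProcessCondition P N A)
    (hη : ∀ᵐ x ∂η, ∀ i, 0 < x i) {L : Ω → ℝ≥0∞} (hL : Measurable L) (hLint : ∫⁻ ω, L ω ∂P ≠ ∞)
    {δ : ℝ≥0∞} (hδ : 0 < δ) :
    ∃ s : ℝ, 0 < s ∧
      ∫⁻ ω in {ω | N ω = 1}ᶜ, L ω * η {y | vecNorm (A 1 ω *ᵥ y) < s} ∂P < δ := by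
  set T : Set Ω := {ω | N ω = 1}ᶜ with hT
  have hTm : MeasurableSet T := (hN (measurableSet_singleton 1)).compl
  set F : ℕ → Ω → ℝ≥0∞ := fun m ω =>
    L ω * η {y | vecNorm (A 1 ω *ᵥ y) < 1 / ((m : ℝ) + 1)} with hF
  have hLfin : ∀ᵐ ω ∂(P.restrict T), L ω < ∞ := ae_restrict_of_ae (ae_lt_top hL hLint)
  have hlim : Tendsto (fun m => ∫⁻ ω in T, F m ω ∂P) atTop (𝓝 (∫⁻ ω in T, 0 ∂P)) := by
    refine tendsto_lintegral_of_dominated_convergence L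
      (fun m => hL.mul (measurable_smallBall hA 1 _)) (fun m => ?_) ?_ ?_
    · exact .of_forall fun ω => mul_le_of_le_one_right' prob_le_one
    · exact ((setLIntegral_le_lintegral _ _).trans_lt hLint.lt_top).ne
    · filter_upwards [hLfin, ae_restrict_of_ae hcond.one_le, ae_restrict_of_ae hcond.nonneg,
        ae_restrict_of_ae hcond.ne_zero, ae_restrict_mem hTm] with ω h1 h2 h3 h4 h5
      -- Hence `A 1 ω` is nonzero, and `A 1 ω *ᵥ y` vanishes for almost no `y`: the small balls
      -- shrink to a null set.
      have hN2 : 1 < N ω := lt_of_le_of_ne h2 (Ne.symm h5)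
      have hmeasv : Measurable fun y => vecNorm (A 1 ω *ᵥ y) :=
        measurable_vecNorm.comp
          (measurable_apply_mulVec (hA 1) (measurable_const (a := ω)) measurable_id)
      have hball : Tendsto (fun m : ℕ => η {y | vecNorm (A 1 ω *ᵥ y) < 1 / ((m : ℝ) + 1)}) atTop
          (𝓝 (η (⋂ m : ℕ, {y | vecNorm (A 1 ω *ᵥ y) < 1 / ((m : ℝ) + 1)}))) := by
        refine tendsto_measure_iInter_atTop
          (fun m => (measurableSet_lt hmeasv measurable_const).nullMeasurableSet)
          (fun m n hmn => Set.ofPred_subset_ofPred.2 fun y hy => lt_of_lt_of_le hy ?_) ⟨0, measure_ne_top _ _⟩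
        exact one_div_le_one_div_of_le (by positivity) (by gcongr)
      have hzero : η (⋂ m : ℕ, {y | vecNorm (A 1 ω *ᵥ y) < 1 / ((m : ℝ) + 1)}) = 0 := by
        rw [measure_eq_zero_iff_ae_notMem]
        filter_upwards [hη] with y hy hmem
        obtain ⟨m, hm⟩ := exists_nat_one_div_lt (vecNorm_mulVec_pos (h3 1) (h4 1 hN2) hy)
        exact lt_asymm hm (Set.mem_iInter.1 hmem m)
      rw [hzero] at hball
      have h := ENNReal.Tendsto.const_mul hball (Or.inr h1.ne)
      rwa [mul_zero] at h
  rw [lintegral_zero] at hlim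
  obtain ⟨m, hm⟩ := (hlim.eventually_lt_const hδ).exists
  exact ⟨1 / ((m : ℝ) + 1), by positivity, hm⟩

/-- If the unnormalised moments of the products decay geometrically, then the fixed point has a
finite negative moment. -/
theorem lintegral_negPow_lt_top [IsProbabilityMeasure P] (hN : Measurable N)
    (hA : ∀ i j k, Measurable fun ω => A i ω j k)
    (hcond : PointProcessCondition P N A) (hc : 1 ≤ c) (hFK : ∀ᵐ ω ∂P, IsFK c (A 0 ω))
    (hfix : smoothingTransform P N A η = η) (hη : ∀ᵐ x ∂η, ∀ i, 0 ≤ x i)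
    (hη0 : ∀ᵐ x ∂η, x ≠ 0) (ha : 0 < a) (hmom : matMoment P (A 0) (-a) < ∞)
    (hp : P {ω | N ω = 1} < 1) {r : ℝ≥0∞} (hr : r ≠ ∞) (hr1 : 1 < r) {g : ℕ → ℝ≥0∞}
    (hg : ∀ k x, (∀ i, 0 ≤ x i) →
      iterMoment (P.restrict {ω | N ω = 1}) (A 0) a k x ≤ g k * negPow a x)
    (hsum : ∑' k, r ^ k * g k ≠ ∞) : ∫⁻ x, negPow a x ∂η < ∞ := by
  have hc0 : 0 < c := one_pos.trans_le hc
  set S : Set Ω := {ω | N ω = 1} with hS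
  set μ := P.restrict S with hμ
  set V := green μ (A 0) a r with hV
  set C : ℝ≥0∞ := ∑' k, r ^ k * g k with hC
  have hVm : Measurable V := measurable_green (hA 0)
  have hVanti : ∀ {x y : Fin d → ℝ}, (∀ i, 0 ≤ x i) → (∀ i, x i ≤ y i) → V y ≤ V x :=
    fun hx hxy => green_anti ha.le (ae_restrict_of_ae (hFK.mono fun ω h => h.nonneg)) hx hxy
  have hVC : ∀ x : Fin d → ℝ, (∀ i, 0 ≤ x i) → V x ≤ C * negPow a x := fun x hx => by
    rw [hC, ← ENNReal.tsum_mul_right]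
    refine ENNReal.tsum_le_tsum fun k => ?_
    rw [mul_assoc]
    gcongr
    exact hg k x hx
  -- Bounds the growth of `V` under `A 0 ω`. The maximum with `1` keeps the bound valid for the
  -- truncations of `V`.
  set L : Ω → ℝ≥0∞ := fun ω =>
    max (C * (ENNReal.ofReal c ^ a * ENNReal.ofReal (opNorm (A 0 ω)) ^ (-a))) 1 with hL
  have hLm : Measurable L :=
    (((measurable_opNorm (hA 0)).ennreal_ofReal.pow_const _).const_mul _ |>.const_mul _).max
      measurable_const
  have hca : ENNReal.ofReal c ^ a ≠ ∞ := ENNReal.rpow_ne_top_of_nonneg ha.le ENNReal.ofReal_ne_top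
  have hLint : ∫⁻ ω, L ω ∂P ≠ ∞ := by
    refine ((lintegral_mono fun ω => max_le_add_of_nonneg zero_le zero_le).trans_lt ?_).ne
    rw [lintegral_add_right _ measurable_const, lintegral_const_mul' _ _ hsum,
      lintegral_const_mul' _ _ hca]
    simpa [matMoment] using ENNReal.mul_lt_top hsum.lt_top (ENNReal.mul_lt_top hca.lt_top hmom)
  -- Contraction rate of `min (V x) n` on `N = 1`: `V` contracts by `r⁻¹`, the constant `n` by `P
  -- S`.
  set ρ : ℝ≥0∞ := max r⁻¹ (P S) with hρ
  have hρ1 : ρ < 1 := max_lt (ENNReal.inv_lt_one.2 hr1) hp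
  obtain ⟨t, hρt, ht1⟩ := exists_between hρ1
  -- The radius `s` is chosen so that the rare event on `N ≥ 2` costs less than `t - ρ`, for a total
  -- factor `t < 1`.
  obtain ⟨s, hs, hsmall⟩ := exists_lintegral_smallBall_lt hN hA hcond
    (ae_pos_of_fixedPoint hN hA hcond hFK hfix hη hη0) hLm hLint (tsub_pos_of_lt hρt)
  set D : ℝ≥0∞ := C * ENNReal.ofReal s ^ (-a) with hD
  have hDfin : D ≠ ∞ :=
    ENNReal.mul_ne_top hsum (ENNReal.rpow_ne_top_of_ne_zero (by simpa using hs) ENNReal.ofReal_ne_top)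
  set f : ℕ → (Fin d → ℝ) → ℝ≥0∞ := fun n x => min (V x) n with hf
  have hfm : ∀ n, Measurable (f n) := fun n => hVm.min measurable_const
  -- the contribution of `N = 1`
  have hone : ∀ n x, ∫⁻ ω, f n (A 0 ω *ᵥ x) ∂μ ≤ ρ * f n x := fun n x => by
    have h1 : ∫⁻ ω, f n (A 0 ω *ᵥ x) ∂μ ≤ ρ * V x := by
      have h := mul_lintegral_green_le (ν := μ) (a := a) (r := r) (hA 0) x
      calc ∫⁻ ω, f n (A 0 ω *ᵥ x) ∂μ ≤ ∫⁻ ω, V (A 0 ω *ᵥ x) ∂μ :=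
            lintegral_mono fun ω => min_le_left _ _
        _ = r⁻¹ * (r * ∫⁻ ω, V (A 0 ω *ᵥ x) ∂μ) := by
            rw [← mul_assoc, ENNReal.inv_mul_cancel (one_pos.trans hr1).ne' hr, one_mul]
        _ ≤ ρ * V x := by
            gcongr
            exact le_max_left _ _
    have h2 : ∫⁻ ω, f n (A 0 ω *ᵥ x) ∂μ ≤ ρ * n := by
      calc ∫⁻ ω, f n (A 0 ω *ᵥ x) ∂μ ≤ ∫⁻ _, (n : ℝ≥0∞) ∂μ :=
            lintegral_mono fun ω => min_le_right _ _
        _ = P S * n := by rw [lintegral_const, hμ, Measure.restrict_apply_univ, mul_comm]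
        _ ≤ ρ * n := by
            gcongr
            exact le_max_right _ _
    rcases le_total (V x) n with h | h
    · rw [hf]; dsimp only; rwa [min_eq_left h]
    · rw [hf]; dsimp only; rwa [min_eq_right h]
  -- the contribution of `N ≥ 2`
  have hfL : ∀ n ω x, IsFK c (A 0 ω) → (∀ i, 0 ≤ x i) → f n (A 0 ω *ᵥ x) ≤ L ω * f n x :=
    fun n ω x hω hx => by
    have h1 : V (A 0 ω *ᵥ x) ≤ L ω * V x := by
      calc V (A 0 ω *ᵥ x) ≤ C * negPow a (A 0 ω *ᵥ x) := hVC _ (mulVec_nonneg hω.nonneg hx)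
        _ ≤ C * (ENNReal.ofReal c ^ a * (ENNReal.ofReal (opNorm (A 0 ω)) ^ (-a) * negPow a x)) := by
            gcongr
            exact negPow_mulVec_le ha.le hc0 (hω.opNorm_mul_vecNorm_le hc0.le hx)
        _ = C * (ENNReal.ofReal c ^ a * ENNReal.ofReal (opNorm (A 0 ω)) ^ (-a)) * negPow a x := by
            ring
        _ ≤ L ω * V x := by
            gcongr
            · exact le_max_left _ _
            · exact negPow_le_green x
    have h2 : (n : ℝ≥0∞) ≤ L ω * n := le_mul_of_one_le_left zero_le (le_max_right _ _)
    rw [hf]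
    dsimp only
    rcases le_total (V x) n with h | h
    · rw [min_eq_left h]; exact (min_le_left _ _).trans h1
    · rw [min_eq_right h]; exact (min_le_right _ _).trans h2
  set Q := P.prod (Measure.infinitePi fun _ : ℕ => η) with hQ
  have htwo : ∀ n, ∫⁻ p in Prod.fst ⁻¹' Sᶜ, f n (smoothSum N A p) ∂Q ≤
      (t - ρ) * ∫⁻ x, f n x ∂η + D := fun n => by
    set G : Ω × (ℕ → Fin d → ℝ) → ℝ≥0∞ := fun p =>
      L p.1 * (Set.indicator {q : Ω × (Fin d → ℝ) | vecNorm (A 1 q.1 *ᵥ q.2) < s} 1 (p.1, p.2 1) *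
        f n (p.2 0)) with hG
    have hBm : MeasurableSet {q : Ω × (Fin d → ℝ) | vecNorm (A 1 q.1 *ᵥ q.2) < s} :=
      measurableSet_lt (measurable_vecNorm.comp
        (measurable_apply_mulVec (hA 1) measurable_fst measurable_snd)) measurable_const
    have hind : Measurable (Set.indicator
        {q : Ω × (Fin d → ℝ) | vecNorm (A 1 q.1 *ᵥ q.2) < s} (1 : Ω × (Fin d → ℝ) → ℝ≥0∞)) :=
      measurable_one.indicator hBm
    have hGm : Measurable G :=
      (hLm.comp measurable_fst).mul ((hind.comp (measurable_fst.prodMk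
        ((measurable_pi_apply 1).comp measurable_snd))).mul
        ((hfm n).comp ((measurable_pi_apply 0).comp measurable_snd)))
    have hTm : MeasurableSet (Prod.fst ⁻¹' Sᶜ : Set (Ω × (ℕ → Fin d → ℝ))) :=
      measurable_fst (hN (measurableSet_singleton 1)).compl
    -- As `V` is decreasing, either summand may be dropped: the second when it is small (term `G`),
    -- the first otherwise (term `D`).
    have hpt : ∀ᵐ p ∂(Q.restrict (Prod.fst ⁻¹' Sᶜ)), f n (smoothSum N A p) ≤ G p + D := by
      filter_upwards [ae_restrict_of_ae (ae_prod_of_ae_fst hcond.one_le),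
        ae_restrict_of_ae (ae_prod_of_ae_fst hcond.nonneg),
        ae_restrict_of_ae (ae_prod_of_ae_fst hFK),
        ae_restrict_of_ae (ae_prod_of_ae_snd (ae_infinitePi_forall hη)),
        ae_restrict_mem hTm] with p h1 h2 h3 h4 h5
      have hN2 : 2 ≤ N p.1 := lt_of_le_of_ne h1 (Ne.symm h5)
      have hle : ∀ j, (A 0 p.1 *ᵥ p.2 0) j + (A 1 p.1 *ᵥ p.2 1) j ≤ smoothSum N A p j := fun j => by
        simpa [Finset.sum_range_succ] using sum_le_smoothSum h2 h4 hN2 j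
      have hnn : ∀ i j, 0 ≤ (A i p.1 *ᵥ p.2 i) j := fun i => mulVec_nonneg (h2 i) (h4 i)
      by_cases hlt : vecNorm (A 1 p.1 *ᵥ p.2 1) < s
      · refine le_trans ?_ le_self_add
        rw [hG]
        dsimp only
        rw [Set.indicator_of_mem (by exact hlt), Pi.one_apply, one_mul]
        refine le_trans (min_le_min_right _ ?_) (hfL n p.1 (p.2 0) h3 (h4 0))
        exact hVanti (hnn 0) fun j => (le_add_of_nonneg_right (hnn 1 j)).trans (hle j)
      · refine le_trans ?_ le_add_self
        calc f n (smoothSum N A p) ≤ V (smoothSum N A p) := min_le_left _ _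
          _ ≤ V (A 1 p.1 *ᵥ p.2 1) :=
            hVanti (hnn 1) fun j => (le_add_of_nonneg_left (hnn 0 j)).trans (hle j)
          _ ≤ C * negPow a (A 1 p.1 *ᵥ p.2 1) := hVC _ (hnn 1)
          _ ≤ D := by
            rw [hD]
            gcongr
            exact rpow_neg_anti ha.le (ENNReal.ofReal_le_ofReal (not_lt.1 hlt))
    -- Given `ω`, the indicator depends only on `z 1` and `f n` only on `z 0`, so the integral
    -- factorises.
    have hGint : ∫⁻ p in Prod.fst ⁻¹' Sᶜ, G p ∂Q =
        (∫⁻ ω in Sᶜ, L ω * η {y | vecNorm (A 1 ω *ᵥ y) < s} ∂P) * ∫⁻ x, f n x ∂η := by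
      have hLs : Measurable fun ω => L ω * η {y | vecNorm (A 1 ω *ᵥ y) < s} :=
        hLm.mul (measurable_smallBall hA 1 s)
      rw [hQ, setLIntegral_prod_fst _ hGm, ← lintegral_mul_const _ hLs]
      refine lintegral_congr fun ω => ?_
      have hind' := hind.comp (measurable_prodMk_left (x := ω))
      rw [hG]
      dsimp only
      have hprod : Measurable fun z : ℕ → Fin d → ℝ => Set.indicator
          {q : Ω × (Fin d → ℝ) | vecNorm (A 1 q.1 *ᵥ q.2) < s} (1 : Ω × (Fin d → ℝ) → ℝ≥0∞)
          (ω, z 1) * f n (z 0) :=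
        (hind'.comp (measurable_pi_apply 1)).mul ((hfm n).comp (measurable_pi_apply 0))
      rw [lintegral_const_mul _ hprod, mul_assoc]
      congr 1
      refine (lintegral_infinitePi_mul hind' (hfm n) one_ne_zero).trans ?_
      congr 1
      exact lintegral_indicator_one (measurable_prodMk_left hBm)
    calc ∫⁻ p in Prod.fst ⁻¹' Sᶜ, f n (smoothSum N A p) ∂Q
        ≤ ∫⁻ p in Prod.fst ⁻¹' Sᶜ, (G p + D) ∂Q := lintegral_mono_ae hpt
      _ = ∫⁻ p in Prod.fst ⁻¹' Sᶜ, G p ∂Q + D * Q (Prod.fst ⁻¹' Sᶜ) := by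
          rw [lintegral_add_left hGm, setLIntegral_const]
      _ ≤ (t - ρ) * ∫⁻ x, f n x ∂η + D := by
          rw [hGint]
          gcongr
          exact mul_le_of_le_one_right' prob_le_one
  have hbound : ∀ n, ∫⁻ x, f n x ∂η ≤ (1 - t)⁻¹ * D := fun n => by
    refine le_of_le_mul_add ?_ ht1 ?_
    · refine ((lintegral_mono fun x => min_le_right _ _).trans_lt (?_ : _ < ∞)).ne
      simp
    · calc ∫⁻ x, f n x ∂η = ∫⁻ x, ∫⁻ ω, f n (A 0 ω *ᵥ x) ∂μ ∂η +
            ∫⁻ p in Prod.fst ⁻¹' Sᶜ, f n (smoothSum N A p) ∂Q :=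
            lintegral_eq_of_fixedPoint hN hA hfix (hfm n)
        _ ≤ ρ * ∫⁻ x, f n x ∂η + ((t - ρ) * ∫⁻ x, f n x ∂η + D) := by
            gcongr
            · rw [← lintegral_const_mul _ (hfm n)]
              exact lintegral_mono fun x => hone n x
            · exact htwo n
        _ = t * ∫⁻ x, f n x ∂η + D := by
            rw [← add_assoc, ← add_mul, add_tsub_cancel_of_le hρt.le]
  calc ∫⁻ x, negPow a x ∂η ≤ ∫⁻ x, V x ∂η := lintegral_mono fun x => negPow_le_green x
    _ = ∫⁻ x, ⨆ n, f n x ∂η := by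
        refine lintegral_congr fun x => ?_
        change V x = ⨆ n : ℕ, V x ⊓ (n : ℝ≥0∞)
        rw [← inf_iSup_eq, ENNReal.iSup_natCast, inf_top_eq]
    _ = ⨆ n, ∫⁻ x, f n x ∂η := lintegral_iSup hfm fun m n hmn x =>
        min_le_min_left _ (by exact_mod_cast hmn)
    _ ≤ (1 - t)⁻¹ * D := iSup_le hbound
    _ < ∞ := ENNReal.mul_lt_top (ENNReal.inv_lt_top.2 (tsub_pos_of_lt ht1)) hDfin.lt_top

end Finiteness

/-! ### Reduction of the theorem to moments of the law of `Z`. -/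

section Main

variable {Ω Ω' : Type*} [MeasurableSpace Ω] [MeasurableSpace Ω'] {P : Measure Ω}
  [IsProbabilityMeasure P] {d : ℕ} {N : Ω → ℕ} {A : ℕ → Ω → Matrix (Fin d) (Fin d) ℝ}

theorem PointProcessCondition.measure_compl_ne_zero (hcond : PointProcessCondition P N A) :
    P {ω | N ω = 1}ᶜ ≠ 0 := fun h => by
  have h1 : ∀ᵐ ω ∂P, N ω = 1 := h
  have h2 : ∫⁻ ω, (N ω : ℝ≥0∞) ∂P = 1 := by
    rw [lintegral_congr_ae (h1.mono fun ω hω => by rw [hω])]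
    simp
  exact (h2 ▸ hcond.one_lt_mean).false

theorem PointProcessCondition.measure_lt_one (hN : Measurable N)
    (hcond : PointProcessCondition P N A) : P {ω | N ω = 1} < 1 := by
  refine prob_le_one.lt_of_ne fun h => hcond.measure_compl_ne_zero ?_
  exact (prob_compl_eq_zero_iff (hN (measurableSet_singleton 1))).2 h

theorem vecMoment_eq_lintegral_map {P' : Measure Ω'} {Z : Ω' → Fin d → ℝ} (hZ : AEMeasurable Z P')
    (a : ℝ) : vecMoment P' Z (-a) = ∫⁻ x, negPow a x ∂(P'.map Z) :=
  (lintegral_map' (measurable_negPow a).aemeasurable hZ).symm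

theorem vecMoment_lt_top_of_lt {P' : Measure Ω'} [IsProbabilityMeasure P'] {Z : Ω' → Fin d → ℝ}
    {a b : ℝ} (hb : 0 < b) (hba : b < a) (h : vecMoment P' Z (-a) < ∞) :
    vecMoment P' Z (-b) < ∞ := by
  have hle : ∀ ω, ENNReal.ofReal (vecNorm (Z ω)) ^ (-b) ≤
      1 + ENNReal.ofReal (vecNorm (Z ω)) ^ (-a) := fun ω => by
    rcases le_total (ENNReal.ofReal (vecNorm (Z ω))) 1 with h1 | h1
    · exact (ENNReal.rpow_le_rpow_of_exponent_ge h1 (neg_le_neg hba.le)).trans le_add_self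
    · exact (ENNReal.rpow_le_one_of_one_le_of_neg h1 (neg_neg_of_pos hb)).trans le_self_add
  refine (lintegral_mono hle).trans_lt ?_
  rw [lintegral_add_left measurable_const]
  simpa [vecMoment] using h

end Main

end Smoothing

theorem mainTheorem4
    {Ω Ω' : Type*} [MeasurableSpace Ω] [MeasurableSpace Ω']
    (P : Measure Ω) [IsProbabilityMeasure P]
    (P' : Measure Ω') [IsProbabilityMeasure P']
    (d : ℕ) (hd : 1 ≤ d)
    (N : Ω → ℕ) (hN : Measurable N)
    (A : ℕ → Ω → Matrix (Fin d) (Fin d) ℝ)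
    (hA : ∀ i j k, Measurable fun ω => A i ω j k)
    (hcond : Smoothing.PointProcessCondition P N A)
    (hFK : Smoothing.FurstenbergKesten P (A 0))
    -- `Z` is an `ℝ₊ᵈ`-valued random variable whose law is a fixed point, and `P[Z = 0] = 0`
    (Z : Ω' → Fin d → ℝ) (hZ : AEMeasurable Z P')
    (hZnonneg : ∀ᵐ ω ∂P', ∀ i, 0 ≤ Z ω i)
    (hfix : Smoothing.smoothingTransform P N A (P'.map Z) = P'.map Z)
    (hZ0 : P' {ω | Z ω = 0} = 0)
    (a : ℝ) (ha : 0 < a)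
    (hmom : Smoothing.matMoment P (A 0) (-a) < ∞) :
    -- the case `P[N = 1] = 0`
    (P {ω | N ω = 1} = 0 →
      ∀ b : ℝ, 0 < b → b < a → Smoothing.vecMoment P' Z (-b) < ∞) ∧
    -- the case `P[N = 1] > 0`
    (0 < P {ω | N ω = 1} →
      -- the limit defining `κ̃(-a)` exists in `(0, ∞)`
      (Tendsto (Smoothing.kappaSeq P N A (-a)) atTop (𝓝 (Smoothing.kappa P N A (-a))) ∧
        0 < Smoothing.kappa P N A (-a) ∧ Smoothing.kappa P N A (-a) < ∞) ∧
      (Smoothing.vecMoment P' Z (-a) < ∞ →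
        Smoothing.kappa P N A (-a) * P {ω | N ω = 1} < 1) ∧
      (Smoothing.kappa P N A (-a) * P {ω | N ω = 1} < 1 →
        ∀ b : ℝ, 0 < b → b < a → Smoothing.vecMoment P' Z (-b) < ∞) ∧
      ((∃ ε : ℝ, 0 < ε ∧ Smoothing.matMoment P (A 0) (-a - ε) < ∞) →
        (Smoothing.vecMoment P' Z (-a) < ∞ ↔
          Smoothing.kappa P N A (-a) * P {ω | N ω = 1} < 1))) := by
  obtain ⟨c, hc, hFK'⟩ := hFK
  have hFKc : ∀ᵐ ω ∂P, Smoothing.IsFK c (A 0 ω) := by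
    filter_upwards [hFK', hcond.nonneg] with ω h1 h2
    exact ⟨h2 0, h1.1, h1.2⟩
  have := Measure.isProbabilityMeasure_map hZ
  have hη : ∀ᵐ x ∂(P'.map Z), ∀ i, 0 ≤ x i := by
    refine (ae_map_iff hZ ?_).2 hZnonneg
    rw [Set.ofPred_forall]
    exact MeasurableSet.iInter fun i => measurableSet_le measurable_const (measurable_pi_apply i)
  have hη0 : ∀ᵐ x ∂(P'.map Z), x ≠ 0 := by
    refine (ae_map_iff hZ (measurableSet_singleton 0).compl).2 ?_
    rw [ae_iff]
    simpa using hZ0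
  have hp1 := hcond.measure_lt_one hN
  refine ⟨fun hp b hb hba => Smoothing.vecMoment_lt_top_of_lt hb hba ?_, fun hp => ?_⟩
  · rw [Smoothing.vecMoment_eq_lintegral_map hZ]
    -- The restriction of `P` to `N = 1` is zero, so only `k = 0` contributes and any finite `r > 1`
    -- would do.
    refine Smoothing.lintegral_negPow_lt_top hN hA hcond hc.le hFKc hfix hη hη0 ha hmom hp1
      (r := 2) (by simp) (by norm_num) (g := fun k => if k = 0 then 1 else 0)
      (fun k x _ => ?_) ?_
    · rw [Measure.restrict_eq_zero.2 hp]
      cases k <;> simp [Smoothing.iterMoment]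
    · rw [tsum_eq_single 0 fun k hk => by simp [hk]]
      simp
  · set p := P {ω | N ω = 1} with hp_def
    set ν := ProbabilityTheory.cond P {ω | N ω = 1} with hν
    have hνprob : IsProbabilityMeasure ν := cond_isProbabilityMeasure hp.ne'
    have hptop : p ≠ ∞ := measure_ne_top _ _
    have hμ : P.restrict {ω | N ω = 1} = p • ν := by
      rw [hν, ProbabilityTheory.cond, smul_smul, ENNReal.mul_inv_cancel hp.ne' hptop, one_smul]
    have hFKν : ∀ᵐ ω ∂ν, Smoothing.IsFK c (A 0 ω) := cond_absolutelyContinuous.ae_le hFKc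
    have hmomν : Smoothing.matMoment ν (A 0) (-a) < ∞ := by
      rw [Smoothing.matMoment, hν, ProbabilityTheory.cond, lintegral_smul_measure]
      exact ENNReal.mul_lt_top (ENNReal.inv_lt_top.2 hp)
        ((setLIntegral_le_lintegral _ _).trans_lt hmom)
    obtain ⟨κ, K, hK0, hK, hlim, hκ0, hκ, hκK, hufin⟩ :=
      Smoothing.exists_growthRate hd ha hc.le (hA 0) hFKν hmomν
    set u : ℕ → ℝ≥0∞ := fun n =>
      Smoothing.matMoment (Measure.pi fun _ : Fin n => ν) (Smoothing.revProd (A 0) n) (-a) with hu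
    have hlim' : Tendsto (Smoothing.kappaSeq P N A (-a)) atTop (𝓝 κ) := hlim
    have hkappa : Smoothing.kappa P N A (-a) = κ := hlim'.limUnder_eq
    have hab : Smoothing.vecMoment P' Z (-a) < ∞ → κ * p < 1 := fun hfin => by
      by_contra! hge
      refine hfin.ne ?_
      rw [Smoothing.vecMoment_eq_lintegral_map hZ]
      refine Smoothing.lintegral_negPow_eq_top hN hA hfix ha hcond.measure_compl_ne_zero
        (ENNReal.inv_ne_zero.2 hK) fun k x => ?_
      rw [hμ, Smoothing.iterMoment_smul p k hptop]
      have h1 : K⁻¹ ≤ p ^ k * u k := by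
        rw [ENNReal.inv_le_iff_le_mul (fun _ => hK0) fun h => absurd h hK]
        calc (1 : ℝ≥0∞) ≤ (κ * p) ^ k := one_le_pow₀ hge
          _ = p ^ k * κ ^ k := by rw [mul_pow, mul_comm]
          _ ≤ p ^ k * (K * u k) := by gcongr; exact hκK k
          _ = K * (p ^ k * u k) := by ring
      calc K⁻¹ * Smoothing.negPow a x ≤ p ^ k * u k * Smoothing.negPow a x := by gcongr
        _ = p ^ k * (u k * Smoothing.negPow a x) := mul_assoc _ _ _
        _ ≤ _ := by
          gcongr
          exact Smoothing.matMoment_mul_negPow_le ha.le (hA 0) k x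
    have hba : κ * p < 1 → Smoothing.vecMoment P' Z (-a) < ∞ := fun hlt => by
      -- With `κ * p < t < l < 1` and `r = l⁻¹`, the terms of the series are eventually at most `c ^
      -- a * (t / l) ^ k`.
      obtain ⟨t, hκt, ht1⟩ := exists_between hlt
      obtain ⟨l, htl, hl1⟩ := exists_between ht1
      have hl0 : l ≠ 0 := (zero_le.trans_lt htl).ne'
      have hltop : l ≠ ∞ := hl1.ne_top
      have hca : ENNReal.ofReal c ^ a ≠ ∞ :=
        ENNReal.rpow_ne_top_of_nonneg ha.le ENNReal.ofReal_ne_top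
      rw [Smoothing.vecMoment_eq_lintegral_map hZ]
      refine Smoothing.lintegral_negPow_lt_top hN hA hcond hc.le hFKc hfix hη hη0 ha hmom hp1
        (r := l⁻¹) (ENNReal.inv_ne_top.2 hl0) (ENNReal.one_lt_inv.2 hl1)
        (g := fun k => ENNReal.ofReal c ^ a * (p ^ k * u k)) (fun k x hx => ?_) ?_
      · rw [hμ, Smoothing.iterMoment_smul p k hptop]
        calc p ^ k * Smoothing.iterMoment ν (A 0) a k x
            ≤ p ^ k * (ENNReal.ofReal c ^ a * (u k * Smoothing.negPow a x)) := by
              gcongr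
              exact Smoothing.iterMoment_le_matMoment ha.le hc.le (hA 0) hFKν k hx
          _ = _ := by ring
      · refine Smoothing.tsum_ne_top_of_eventually_le_geometric (C := ENNReal.ofReal c ^ a)
          (r := l⁻¹ * t) (fun k => ?_) hca ?_ ?_
        · exact ENNReal.mul_ne_top (ENNReal.pow_ne_top (ENNReal.inv_ne_top.2 hl0))
            (ENNReal.mul_ne_top hca (ENNReal.mul_ne_top (ENNReal.pow_ne_top hptop) (hufin k)))
        · rw [mul_comm, ← div_eq_mul_inv]
          exact (ENNReal.div_lt_iff (Or.inl hl0) (Or.inl hltop)).2 (by rwa [one_mul])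
        · have hev := (ENNReal.Tendsto.mul_const hlim (Or.inr hptop)).eventually_lt_const hκt
          filter_upwards [hev, eventually_gt_atTop 0] with k hk hk0
          have hk' : (k : ℝ) ≠ 0 := by exact_mod_cast hk0.ne'
          have hroot : (u k ^ ((k : ℝ)⁻¹)) ^ k = u k := by
            rw [← ENNReal.rpow_mul_natCast, inv_mul_cancel₀ hk', ENNReal.rpow_one]
          have hpu : p ^ k * u k ≤ t ^ k := by
            calc p ^ k * u k = (u k ^ ((k : ℝ)⁻¹) * p) ^ k := by rw [mul_pow, hroot, mul_comm]
              _ ≤ t ^ k := pow_le_pow_left₀ zero_le hk.le k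
          calc l⁻¹ ^ k * (ENNReal.ofReal c ^ a * (p ^ k * u k))
              ≤ l⁻¹ ^ k * (ENNReal.ofReal c ^ a * t ^ k) := by gcongr
            _ = _ := by rw [mul_pow]; ring
    rw [hkappa]
    exact ⟨⟨hlim', hκ0, hκ⟩, hab, fun h b hb hb' => Smoothing.vecMoment_lt_top_of_lt hb hb' (hba h),
      fun _ => ⟨hab, hba⟩⟩
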